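/- An $\mathcal F$-category $\mathbb A$ is a (strict) 2-category $\mathcal A_\lambda$, whose 1-cells are called loose, with a chosen class of tight 1-cells containing the identities and closed under composition. $\mathcal A_\tau$ is the 2-category of all objects, tight 1-cells and all 2-cells between these, viewed as an $\mathcal F$-category in which every 1-cell is tight. An $\mathcal F$-functor is a (strict) 2-functor preserving tightness. $\mathbb A^{co}$ is $\mathbb A$ with 2-cells reversed (same tight 1-cells), and $H^{co}:\mathbb A^{co}\to\mathbb B^{co}$ is induced by $H:\mathbb A\to\mathbb B$. **Limits of loose morphisms.** A colax cone over a loose $f:A\to B$ with base $X$ is a triple $(r:X\to A,\ \alpha:s\Rightarrow fr,\ s:X\to B)$. A colax limit of $f$ is an object $C$ with a colax cone $(p,\lambda,q)$ with base $C$ such that (1) for every colax cone $(r,\alpha,s)$ with base $X$ there is a unique $t:X\to C$ with $pt=r$, $qt=s$, $\lambda t=\alpha$; (2) for $t,t':X\to C$ inducing cones $(r,\alpha,s)$, $(r',\alpha',s')$ and 2-cells $\theta_r:r\Rightarrow r'$, $\theta_s:s\Rightarrow s'$ with $\alpha'\circ\theta_s=(f\theta_r)\circ\alpha$ there is a unique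 $\phi:t\Rightarrow t'$ with $p\phi=\theta_r$, $q\phi=\theta_s$; (3) $p,q$ are tight, and $t:X\to C$ is tight if and only if $pt$ and $qt$ are. A pseudolimit of $f$ is defined in the same way with $\lambda$ invertible and only cones with invertible 2-cell considered. A lax limit of $f$ is a colax limit of $f$ in $\mathbb A^{co}$. **Doctrinal $\mathcal F$-functors.** An $l$-reflection is an adjunction $(1,f\dashv g,\eta)$ in $\mathcal A_\lambda$ with $f$ tight and identity counit (so $fg=1$); a $p$-reflection is an $l$-reflection with $\eta$ invertible. For $w\in\{l,p\}$, given $w$-reflections $(1,f_1\dashv g_1,\eta_1)$ and $(1,f_2\dashv g_2,\eta_2)$, a commutative square $f_2r=sf_1$ with $r,s$ tight is a morphism of $w$-reflections if $rg_1=g_2s$ and $r\eta_1=\eta_2r$. For $w\in\{l,p\}$ an $\mathcal F$-functor $H:\mathbb B\to\mathbb C$ satisfies $w$-Refl if for each tight $f$ in $\mathbb B$ every $w$-reflection $(1,Hf\dashv g,\eta)$ in $\mathbb C$ is the image under $H$ of a unique $w$-reflection with left adjoint $f$; it satisfies $w$-Morph if, for any two $w$-reflections $(1,f_1\dashv g_1,\eta_1)$,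 $(1,f_2\dashv g_2,\eta_2)$ in $\mathbb B$, a tight commutative square $(r,s):f_1\to f_2$ is a morphism of $w$-reflections if and only if its image $(Hr,Hs):Hf_1\to Hf_2$ is one. $H$ satisfies $c$-Refl, $c$-Morph if $H^{co}$ satisfies $l$-Refl, $l$-Morph respectively. For $w\in\{l,p,c\}$, $H$ is $w$-doctrinal if it satisfies $w$-Refl and $w$-Morph and is locally faithful, i.e. for all parallel 2-cells $\alpha,\beta$ between loose 1-cells, $H\alpha=H\beta$ implies $\alpha=\beta$. **Theorem.** Let $w\in\{l,p,c\}$ and let $\mathbb A$ be an $\mathcal F$-category in which every loose morphism has a colax limit (if $w=l$), a pseudolimit (if $w=p$), or a lax limit (if $w=c$). Then the inclusion $j:\mathcal A_\tau\to\mathbb A$ is orthogonal to every $w$-doctrinal $\mathcal F$-functor $H:\mathbb B\to\mathbb C$: for all $\mathcal F$-functors $R:\mathcal A_\tau\to\mathbb B$ and $S:\mathbb A\to\mathbb C$ with $Sj=HR$ there is a unique $\mathcal F$-functor $K:\mathbb A\to\mathbb B$ with $Kj=R$ and $HK=S$. -/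

import Mathlib

open CategoryTheory Bicategory

set_option linter.checkUnivs false

universe w v u w₁ v₁ u₁ w₂ v₂ u₂ w₃ v₃ u₃ w₄ v₄ u₄

/-! ### F-categories and F-functors -/

/-- An F-category: a (strict) 2-category, whose 1-cells are called *loose*, together with a
subcategory of *tight* 1-cells containing all identities. -/
class FCategory (A : Type u) extends Bicategory.{w, v} A, Bicategory.Strict A where
  IsTight : ∀ {a b : A}, (a ⟶ b) → Prop
  tight_id : ∀ a : A, IsTight (𝟙 a)
  tight_comp : ∀ {a b c : A} (f : a ⟶ b) (g : b ⟶ c), IsTight f → IsTight g → IsTight (f ≫ g)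

open FCategory

/-- An F-functor: a 2-functor (between the 2-categories of loose morphisms) preserving
tightness. -/
structure FFunctor (A : Type u₁) [FCategory.{w₁, v₁} A] (B : Type u₂) [FCategory.{w₂, v₂} B]
    extends StrictPseudofunctor A B where
  map_tight : ∀ {a b : A} (f : a ⟶ b), IsTight f → IsTight (map f)

namespace FFunctor

variable {A : Type u₁} [FCategory.{w₁, v₁} A] {B : Type u₂} [FCategory.{w₂, v₂} B]
  {C : Type u₃} [FCategory.{w₃, v₃} C] {D : Type u₄} [FCategory.{w₄, v₄} D]

/-- Composition of F-functors, in diagrammatic order. -/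
def comp (F : FFunctor A B) (G : FFunctor B C) : FFunctor A C where
  toStrictPseudofunctor := F.toStrictPseudofunctor.comp G.toStrictPseudofunctor
  map_tight f hf := G.map_tight _ (F.map_tight f hf)

/-- Orthogonality `J ⊥ H` in the category of F-categories and F-functors: every commutative
square from `J` to `H` has exactly one diagonal filler. -/
def Orthogonal (J : FFunctor A B) (H : FFunctor C D) : Prop :=
  ∀ (R : FFunctor A C) (S : FFunctor B D), J.comp S = R.comp H →
    ∃! K : FFunctor B C, J.comp K = R ∧ K.comp H = S

/-- `H` is locally faithful: it reflects equality of parallel 2-cells (between arbitrary loose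
1-cells). -/
def LocallyFaithful (H : FFunctor A B) : Prop :=
  ∀ ⦃a b : A⦄ ⦃f g : a ⟶ b⦄ (α β : f ⟶ g), H.map₂ α = H.map₂ β → α = β

end FFunctor

/-! ### The 2-category of tight morphisms and its inclusion -/

/-- Objects of the 2-category of tight morphisms of `A`: the objects of `A`. -/
structure TightPart (A : Type u) where
  obj : A

namespace TightPart

variable {A : Type u} [FCategory.{w, v} A]

/-- 1-cells of the 2-category of tight morphisms: the tight 1-cells of `A`. -/
@[ext]
structure Hom (X Y : TightPart A) where
  hom : X.obj ⟶ Y.obj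
  tight : IsTight hom

instance categoryStruct : CategoryStruct (TightPart A) where
  Hom X Y := Hom X Y
  id X := ⟨𝟙 X.obj, tight_id _⟩
  comp f g := ⟨f.hom ≫ g.hom, tight_comp _ _ f.tight g.tight⟩

@[simp] lemma id_hom (X : TightPart A) : (𝟙 X : X ⟶ X).hom = 𝟙 X.obj := rfl

@[simp] lemma comp_hom {X Y Z : TightPart A} (f : X ⟶ Y) (g : Y ⟶ Z) :
    (f ≫ g).hom = f.hom ≫ g.hom := rfl

/-- 2-cells of the 2-category of tight morphisms: all 2-cells of `A`. -/
@[ext]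
structure Hom₂ {X Y : TightPart A} (f g : X ⟶ Y) where
  hom : f.hom ⟶ g.hom

instance homCategory (X Y : TightPart A) : Category (X ⟶ Y) where
  Hom f g := Hom₂ f g
  id f := ⟨𝟙 f.hom⟩
  comp α β := ⟨α.hom ≫ β.hom⟩

@[ext] lemma hom₂_ext {X Y : TightPart A} {f g : X ⟶ Y} {α β : f ⟶ g} (h : α.hom = β.hom) :
    α = β := Hom₂.ext h

@[simp] lemma id₂_hom {X Y : TightPart A} (f : X ⟶ Y) : (𝟙 f : f ⟶ f).hom = 𝟙 f.hom := rfl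

@[simp] lemma comp₂_hom {X Y : TightPart A} {f g h : X ⟶ Y} (α : f ⟶ g) (β : g ⟶ h) :
    (α ≫ β).hom = α.hom ≫ β.hom := rfl

@[simp] lemma eqToHom_hom {X Y : TightPart A} {f g : X ⟶ Y} (h : f = g) :
    (eqToHom h).hom = eqToHom (congrArg Hom.hom h) := by cases h; rfl

/-- Invertible 2-cells between tight 1-cells. -/
@[simps]
def isoMk {X Y : TightPart A} {f g : X ⟶ Y} (φ : f.hom ≅ g.hom) : f ≅ g where
  hom := ⟨φ.hom⟩
  inv := ⟨φ.inv⟩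

/-- The 2-category of tight morphisms of `A`. -/
instance bicategory : Bicategory.{w, v} (TightPart A) where
  toCategoryStruct := categoryStruct
  homCategory := homCategory
  whiskerLeft f _ _ η := Hom₂.mk (f.hom ◁ Hom₂.hom η)
  whiskerRight η h := Hom₂.mk (Hom₂.hom η ▷ h.hom)
  associator f g h := isoMk (α_ f.hom g.hom h.hom)
  leftUnitor f := isoMk (λ_ f.hom)
  rightUnitor f := isoMk (ρ_ f.hom)
  whisker_exchange _ _ := hom₂_ext (whisker_exchange _ _)

/-- The 2-category of tight morphisms of `A`, viewed as an F-category in which all 1-cells are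
tight. -/
instance fCategory : FCategory.{w, v} (TightPart A) where
  id_comp f := Hom.ext (Strict.id_comp f.hom)
  comp_id f := Hom.ext (Strict.comp_id f.hom)
  assoc f g h := Hom.ext (Strict.assoc f.hom g.hom h.hom)
  leftUnitor_eqToIso f := by
    ext; exact (congrArg Iso.hom (Strict.leftUnitor_eqToIso f.hom)).trans (by simp)
  rightUnitor_eqToIso f := by
    ext; exact (congrArg Iso.hom (Strict.rightUnitor_eqToIso f.hom)).trans (by simp)
  associator_eqToIso f g h := by
    ext; exact (congrArg Iso.hom (Strict.associator_eqToIso f.hom g.hom h.hom)).trans (by simp)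
  IsTight _ := True
  tight_id _ := trivial
  tight_comp _ _ _ _ := trivial

variable (A) in
/-- The inclusion F-functor `j` of the tight part of `A` into `A`. -/
def incl : FFunctor (TightPart A) A where
  toStrictPseudofunctor := StrictPseudofunctor.mk''
    { obj := fun X => X.obj
      map := fun f => f.hom
      map₂ := fun α => α.hom
      map₂_id := fun _ => rfl
      map₂_comp := fun _ _ => rfl
      map_id := fun _ => rfl
      map_comp := fun _ _ => rfl
      map₂_whisker_left := fun f _ _ η => by
        change f.hom ◁ η.hom = _; simp
      map₂_whisker_right := fun η g => by
        change η.hom ▷ g.hom = _; simp }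
  map_tight f _ := f.tight

end TightPart

/-! ### The dual `Aᶜᵒ`, obtained by reversing 2-cells -/

/-- Objects of the dual `Aᶜᵒ`: the objects of `A`. -/
structure Co (A : Type u) where
  obj : A

namespace Co

variable {A : Type u} [FCategory.{w, v} A]

/-- 1-cells of `Aᶜᵒ`: the 1-cells of `A`, in the same direction. -/
@[ext]
structure Hom (X Y : Co A) where
  hom : X.obj ⟶ Y.obj

instance categoryStruct : CategoryStruct (Co A) where
  Hom X Y := Hom X Y
  id X := ⟨𝟙 X.obj⟩
  comp f g := ⟨f.hom ≫ g.hom⟩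

@[simp] lemma id_hom (X : Co A) : (𝟙 X : X ⟶ X).hom = 𝟙 X.obj := rfl

@[simp] lemma comp_hom {X Y Z : Co A} (f : X ⟶ Y) (g : Y ⟶ Z) :
    (f ≫ g).hom = f.hom ≫ g.hom := rfl

/-- 2-cells `f ⟶ g` of `Aᶜᵒ`: the 2-cells `g ⟶ f` of `A`. -/
@[ext]
structure Hom₂ {X Y : Co A} (f g : X ⟶ Y) where
  hom : g.hom ⟶ f.hom

instance homCategory (X Y : Co A) : Category (X ⟶ Y) where
  Hom f g := Hom₂ f g
  id f := ⟨𝟙 f.hom⟩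
  comp α β := ⟨β.hom ≫ α.hom⟩

@[ext] lemma hom₂_ext {X Y : Co A} {f g : X ⟶ Y} {α β : f ⟶ g} (h : α.hom = β.hom) :
    α = β := Hom₂.ext h

@[simp] lemma id₂_hom {X Y : Co A} (f : X ⟶ Y) : (𝟙 f : f ⟶ f).hom = 𝟙 f.hom := rfl

@[simp] lemma comp₂_hom {X Y : Co A} {f g h : X ⟶ Y} (α : f ⟶ g) (β : g ⟶ h) :
    (α ≫ β).hom = β.hom ≫ α.hom := rfl

@[simp] lemma eqToHom_hom {X Y : Co A} {f g : X ⟶ Y} (h : f = g) :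
    (eqToHom h).hom = eqToHom (congrArg Hom.hom h).symm := by cases h; rfl

/-- Invertible 2-cells of `Aᶜᵒ`. -/
@[simps]
def isoMk {X Y : Co A} {f g : X ⟶ Y} (φ : f.hom ≅ g.hom) : f ≅ g where
  hom := ⟨φ.inv⟩
  inv := ⟨φ.hom⟩

/-- The 2-category `Aᶜᵒ`. -/
instance bicategory : Bicategory.{w, v} (Co A) where
  toCategoryStruct := categoryStruct
  homCategory := homCategory
  whiskerLeft f _ _ η := Hom₂.mk (f.hom ◁ Hom₂.hom η)
  whiskerRight η h := Hom₂.mk (Hom₂.hom η ▷ h.hom)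
  associator f g h := isoMk (α_ f.hom g.hom h.hom)
  leftUnitor f := isoMk (λ_ f.hom)
  rightUnitor f := isoMk (ρ_ f.hom)
  whisker_exchange _ _ := hom₂_ext (whisker_exchange _ _).symm

/-- The F-category `Aᶜᵒ`, with the same tight 1-cells as `A`. -/
instance fCategory : FCategory.{w, v} (Co A) where
  id_comp f := Hom.ext (Strict.id_comp f.hom)
  comp_id f := Hom.ext (Strict.comp_id f.hom)
  assoc f g h := Hom.ext (Strict.assoc f.hom g.hom h.hom)
  leftUnitor_eqToIso f := by
    ext; exact (congrArg Iso.inv (Strict.leftUnitor_eqToIso f.hom)).trans (by simp)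
  rightUnitor_eqToIso f := by
    ext; exact (congrArg Iso.inv (Strict.rightUnitor_eqToIso f.hom)).trans (by simp)
  associator_eqToIso f g h := by
    ext; exact (congrArg Iso.inv (Strict.associator_eqToIso f.hom g.hom h.hom)).trans (by simp)
  IsTight f := IsTight f.hom
  tight_id X := tight_id X.obj
  tight_comp f g := tight_comp f.hom g.hom

end Co

namespace FFunctor

variable {A : Type u₁} [FCategory.{w₁, v₁} A] {B : Type u₂} [FCategory.{w₂, v₂} B]

/-- The F-functor `Hᶜᵒ : Aᶜᵒ → Bᶜᵒ` induced by `H : A → B`. -/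
def co (H : FFunctor A B) : FFunctor (Co A) (Co B) where
  toStrictPseudofunctor := StrictPseudofunctor.mk''
    { obj := fun X => ⟨H.obj X.obj⟩
      map := fun f => ⟨H.map f.hom⟩
      map₂ := fun α => ⟨H.map₂ α.hom⟩
      map₂_id := fun f => Co.hom₂_ext (H.map₂_id f.hom)
      map₂_comp := fun α β => Co.hom₂_ext (H.map₂_comp β.hom α.hom)
      map_id := fun X => Co.Hom.ext (H.map_id X.obj)
      map_comp := fun f g => Co.Hom.ext (H.map_comp f.hom g.hom)
      map₂_whisker_left := fun f _ _ η => by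
        ext
        exact (H.map₂_whisker_left f.hom η.hom).trans (by simp [H.mapComp_eq_eqToIso]; rfl)
      map₂_whisker_right := fun η g => by
        ext
        exact (H.map₂_whisker_right η.hom g.hom).trans (by simp [H.mapComp_eq_eqToIso]; rfl) }
  map_tight f hf := H.map_tight f.hom hf

end FFunctor

/-! ### Limits of loose morphisms -/

section Limits

variable {A : Type u} [FCategory.{w, v} A]

/-- A colax cone over a loose morphism `f : a ⟶ b` with base `x`:  1-cells `p : x ⟶ a` and
`q : x ⟶ b` with a 2-cell from `q` to the composite of `p` and `f`. -/
@[ext]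
structure ColaxCone {a b : A} (f : a ⟶ b) (x : A) where
  p : x ⟶ a
  q : x ⟶ b
  cell : q ⟶ p ≫ f

namespace ColaxCone

variable {a b : A} {f : a ⟶ b}

/-- Restriction of a colax cone along a 1-cell `t` into its base. -/
def precomp {l x : A} (c : ColaxCone f l) (t : x ⟶ l) : ColaxCone f x where
  p := t ≫ c.p
  q := t ≫ c.q
  cell := t ◁ c.cell ≫ (α_ t c.p f).inv

/-- A pseudo-cone is a colax cone with invertible 2-cell. -/
def IsPseudo {x : A} (c : ColaxCone f x) : Prop := IsIso c.cell

/-- The 2-dimensional universal property of a limit cone `c` with base `l`. The factorisations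
`t`, `t'` determine the two cones that they factorise. -/
def TwoDimUniversal {l : A} (c : ColaxCone f l) : Prop :=
  ∀ ⦃x : A⦄ (t t' : x ⟶ l)
    (θp : (c.precomp t).p ⟶ (c.precomp t').p) (θq : (c.precomp t).q ⟶ (c.precomp t').q),
    θq ≫ (c.precomp t').cell = (c.precomp t).cell ≫ θp ▷ f →
      ∃! φ : t ⟶ t', φ ▷ c.p = θp ∧ φ ▷ c.q = θq

/-- The projections of the cone are tight and jointly detect tightness. -/
def DetectsTight {l : A} (c : ColaxCone f l) : Prop :=
  IsTight c.p ∧ IsTight c.q ∧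
    ∀ ⦃x : A⦄ (t : x ⟶ l), IsTight t ↔ IsTight (t ≫ c.p) ∧ IsTight (t ≫ c.q)

/-- `c` exhibits its base as the (F-categorical) colax limit of `f`. Equality
`c.precomp t = d` of cones says that `t` composes with both projections of `c`, and with its
2-cell, to the data of `d`. -/
structure IsColaxLimit {l : A} (c : ColaxCone f l) : Prop where
  existsUnique_factor : ∀ ⦃x : A⦄ (d : ColaxCone f x), ∃! t : x ⟶ l, c.precomp t = d
  twoDimUniversal : c.TwoDimUniversal
  detectsTight : c.DetectsTight

/-- `c` exhibits its base as the (F-categorical) pseudolimit of `f`. -/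
structure IsPseudolimit {l : A} (c : ColaxCone f l) : Prop where
  isPseudo : c.IsPseudo
  existsUnique_factor :
    ∀ ⦃x : A⦄ (d : ColaxCone f x), d.IsPseudo → ∃! t : x ⟶ l, c.precomp t = d
  twoDimUniversal : c.TwoDimUniversal
  detectsTight : c.DetectsTight

end ColaxCone

variable (A)

/-- `A` has colax limits of loose morphisms. -/
def HasColaxLimits : Prop :=
  ∀ ⦃a b : A⦄ (f : a ⟶ b), ∃ (l : A) (c : ColaxCone f l), c.IsColaxLimit

/-- `A` has pseudolimits of loose morphisms. -/
def HasPseudolimits : Prop :=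
  ∀ ⦃a b : A⦄ (f : a ⟶ b), ∃ (l : A) (c : ColaxCone f l), c.IsPseudolimit

/-- `A` has lax limits of loose morphisms; these are the colax limits in `Aᶜᵒ`. -/
def HasLaxLimits : Prop := HasColaxLimits (Co A)

end Limits

/-! ### Reflections and doctrinal F-functors -/

section Reflections

variable {A : Type u₁} [FCategory.{w₁, v₁} A] {B : Type u₂} [FCategory.{w₂, v₂} B]

/-- An `l`-reflection with left adjoint `f`: an adjunction `f ⊣ right` (in the 2-category of
loose morphisms) whose left adjoint `f` is tight and whose counit is an identity. -/
@[ext]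
structure LReflection {a b : A} (f : a ⟶ b) where
  right : b ⟶ a
  adj : Bicategory.Adjunction f right
  tight : IsTight f
  right_comp : right ≫ f = 𝟙 b
  counit_eq : adj.counit = eqToHom right_comp

namespace LReflection

/-- A `p`-reflection is an `l`-reflection whose unit is invertible. -/
def IsPseudo {a b : A} {f : a ⟶ b} (ρ : LReflection f) : Prop := IsIso ρ.adj.unit

/-- The image of an `l`-reflection under an F-functor. -/
def map {a b : A} {f : a ⟶ b} (H : FFunctor A B) (ρ : LReflection f) :
    LReflection (H.map f) where
  right := H.map ρ.right
  adj := H.toStrictPseudofunctor.mapAdjunction ρ.adj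
  tight := H.map_tight f ρ.tight
  right_comp := by rw [← H.map_comp, ρ.right_comp, H.map_id]
  counit_eq := by
    rw [StrictPseudofunctor.mapAdjunction_counit', ρ.counit_eq, PrelaxFunctor.map₂_eqToHom]
    simp

/-- The commutative square `r ≫ f₂ = f₁ ≫ s` is a morphism of reflections: the square of right
adjoints commutes as well, and the two whiskerings of the units by `r` agree (up to the
canonical identifications of their domains and codomains). -/
def IsMorphism {a b c d : A} {f₁ : a ⟶ b} {f₂ : c ⟶ d} (ρ₁ : LReflection f₁)
    (ρ₂ : LReflection f₂) (r : a ⟶ c) (s : b ⟶ d) (sq : r ≫ f₂ = f₁ ≫ s) : Prop :=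
  ∃ h : s ≫ ρ₂.right = ρ₁.right ≫ r,
    (λ_ r).inv ≫ ρ₁.adj.unit ▷ r =
      (ρ_ r).inv ≫ r ◁ ρ₂.adj.unit ≫ eqToHom (by
        rw [← Strict.assoc, sq, Strict.assoc, h, Strict.assoc])

end LReflection

namespace FFunctor

lemma map_square (H : FFunctor A B) {a b c d : A} {f₁ : a ⟶ b} {f₂ : c ⟶ d} {r : a ⟶ c}
    {s : b ⟶ d} (sq : r ≫ f₂ = f₁ ≫ s) : H.map r ≫ H.map f₂ = H.map f₁ ≫ H.map s := by
  rw [← H.map_comp, sq, H.map_comp]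

/-- `l`-Refl: `l`-reflections lift uniquely along `H`, for a given tight left adjoint. -/
def LRefl (H : FFunctor A B) : Prop :=
  ∀ ⦃a b : A⦄ (f : a ⟶ b), IsTight f → ∀ σ : LReflection (H.map f),
    ∃! ρ : LReflection f, ρ.map H = σ

/-- `p`-Refl: `p`-reflections lift uniquely along `H`, for a given tight left adjoint. -/
def PRefl (H : FFunctor A B) : Prop :=
  ∀ ⦃a b : A⦄ (f : a ⟶ b), IsTight f → ∀ σ : LReflection (H.map f), σ.IsPseudo →
    ∃! ρ : LReflection f, ρ.IsPseudo ∧ ρ.map H = σ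

/-- `l`-Morph: a tight commutative square between `l`-reflections is a morphism of
`l`-reflections just when its image under `H` is one. -/
def LMorph (H : FFunctor A B) : Prop :=
  ∀ ⦃a b c d : A⦄ ⦃f₁ : a ⟶ b⦄ ⦃f₂ : c ⟶ d⦄ (ρ₁ : LReflection f₁) (ρ₂ : LReflection f₂)
    (r : a ⟶ c) (s : b ⟶ d), IsTight r → IsTight s → ∀ sq : r ≫ f₂ = f₁ ≫ s,
      (ρ₁.IsMorphism ρ₂ r s sq ↔
        (ρ₁.map H).IsMorphism (ρ₂.map H) (H.map r) (H.map s) (H.map_square sq))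

/-- `p`-Morph: a tight commutative square between `p`-reflections is a morphism of
`p`-reflections just when its image under `H` is one. -/
def PMorph (H : FFunctor A B) : Prop :=
  ∀ ⦃a b c d : A⦄ ⦃f₁ : a ⟶ b⦄ ⦃f₂ : c ⟶ d⦄ (ρ₁ : LReflection f₁) (ρ₂ : LReflection f₂),
    ρ₁.IsPseudo → ρ₂.IsPseudo →
    ∀ (r : a ⟶ c) (s : b ⟶ d), IsTight r → IsTight s → ∀ sq : r ≫ f₂ = f₁ ≫ s,
      (ρ₁.IsMorphism ρ₂ r s sq ↔
        (ρ₁.map H).IsMorphism (ρ₂.map H) (H.map r) (H.map s) (H.map_square sq))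

end FFunctor

end Reflections

/-- The three kinds of weakness: `l` (lax), `p` (pseudo) and `c` (colax). -/
inductive Weakness
  | l
  | p
  | c

/-- The involution exchanging lax and colax. -/
def Weakness.bar : Weakness → Weakness
  | l => c
  | p => p
  | c => l

/-- `A` has `w`-limits of loose morphisms. -/
def HasLooseLimits (wk : Weakness) (A : Type u) [FCategory.{w, v} A] : Prop :=
  match wk with
  | .l => HasLaxLimits A
  | .p => HasPseudolimits A
  | .c => HasColaxLimits A

namespace FFunctor

variable {A : Type u₁} [FCategory.{w₁, v₁} A] {B : Type u₂} [FCategory.{w₂, v₂} B]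

/-- `w`-Refl; the case `w = c` is `l`-Refl for `Hᶜᵒ`. -/
def Refl (wk : Weakness) (H : FFunctor A B) : Prop :=
  match wk with
  | .l => H.LRefl
  | .p => H.PRefl
  | .c => H.co.LRefl

/-- `w`-Morph; the case `w = c` is `l`-Morph for `Hᶜᵒ`. -/
def Morph (wk : Weakness) (H : FFunctor A B) : Prop :=
  match wk with
  | .l => H.LMorph
  | .p => H.PMorph
  | .c => H.co.LMorph

/-- `w`-doctrinal F-functors. -/
structure IsDoctrinal (wk : Weakness) (H : FFunctor A B) : Prop where
  refl : H.Refl wk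
  morph : H.Morph wk
  locallyFaithful : H.LocallyFaithful

end FFunctor

/-! Limits of loose morphisms factor every loose 1-cell through tight data. Let `f : a ⟶ b` have
limit `l` with tight projections `p`, `q`. The identity cone over `f` induces `r : a ⟶ l` with `r ≫
p = 𝟙 a` and `r ≫ q = f`, and the 2-dimensional universal property yields a unit making `p ⊣ r` a
reflection whose unit, whiskered by `q`, is the limit cone (`ColaxCone.exists_isLooseLimit`). So `f`
is the right adjoint of a tight reflection followed by a tight 1-cell.

A filler `K` must agree with `R` on `p` and `q`, and must send `r` to the unique lift along `H` of
the image reflection under `S`. This forces the value of `K` on 1-cells; local faithfulness of `H`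
then forces it on 2-cells (`eq_filler`).

For existence, `fill f` is this forced value. The universal property turns any other presentation `g
≫ v = f`, with `g` the right adjoint of a reflection and `v` tight, into a tight morphism of
reflections into the limit, and the Morph condition transfers it to `B` (`lift_square`). Hence
`fill` does not depend on the presentation (`fill_eq`), and composing reflections gives
functoriality (`fill_comp`). On 2-cells it suffices to find some value over `S α` with the right
boundary: by faithfulness it is unique, and all laws follow. Such values are built from lifted units
and from 2-cells between tight 1-cells (`exists_isFill_lax`, `exists_isFill_pseudo`).

The proposition `P` says whether units and cones must be invertible: it is `False` in the lax case
and `True` in the pseudo case. The colax case is the lax case for the duals. -/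

/-! ### Calculus of 2-cells in a strict 2-category

A 2-cell bundled with its domain and codomain can be compared with another one by an honest
equation, so that the associativity and unit laws of whiskering need no transport. -/

/-- A 2-cell together with its domain and codomain. -/
structure TwoCell {A : Type u} [Bicategory.{w, v} A] (a b : A) where
  dom : a ⟶ b
  cod : a ⟶ b
  hom : dom ⟶ cod

namespace TwoCell

section

variable {A : Type u} [Bicategory.{w, v} A] {a b c d : A}

/-- A 2-cell, bundled. -/
def of {f g : a ⟶ b} (α : f ⟶ g) : TwoCell a b := ⟨f, g, α⟩

/-- The identity 2-cell of a 1-cell, bundled. -/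
def one (f : a ⟶ b) : TwoCell a b := ⟨f, f, 𝟙 f⟩

/-- Left whiskering. -/
def wl (f : a ⟶ b) (X : TwoCell b c) : TwoCell a c := ⟨f ≫ X.dom, f ≫ X.cod, f ◁ X.hom⟩

/-- Right whiskering. -/
def wr (X : TwoCell a b) (f : b ⟶ c) : TwoCell a c := ⟨X.dom ≫ f, X.cod ≫ f, X.hom ▷ f⟩

/-- Vertical composition. -/
def comp (X Y : TwoCell a b) (h : X.cod = Y.dom) : TwoCell a b :=
  ⟨X.dom, Y.cod, X.hom ≫ eqToHom h ≫ Y.hom⟩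

/-- Invertibility of a bundled 2-cell. -/
def Inv (X : TwoCell a b) : Prop := IsIso X.hom

@[simp] lemma of_dom {f g : a ⟶ b} (α : f ⟶ g) : (of α).dom = f := rfl
@[simp] lemma of_cod {f g : a ⟶ b} (α : f ⟶ g) : (of α).cod = g := rfl
@[simp] lemma one_dom (f : a ⟶ b) : (one f).dom = f := rfl
@[simp] lemma one_cod (f : a ⟶ b) : (one f).cod = f := rfl
@[simp] lemma wl_dom (f : a ⟶ b) (X : TwoCell b c) : (wl f X).dom = f ≫ X.dom := rfl
@[simp] lemma wl_cod (f : a ⟶ b) (X : TwoCell b c) : (wl f X).cod = f ≫ X.cod := rfl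
@[simp] lemma wr_dom (X : TwoCell a b) (f : b ⟶ c) : (wr X f).dom = X.dom ≫ f := rfl
@[simp] lemma wr_cod (X : TwoCell a b) (f : b ⟶ c) : (wr X f).cod = X.cod ≫ f := rfl
@[simp] lemma comp_dom (X Y : TwoCell a b) (h : X.cod = Y.dom) : (comp X Y h).dom = X.dom := rfl
@[simp] lemma comp_cod (X Y : TwoCell a b) (h : X.cod = Y.dom) : (comp X Y h).cod = Y.cod := rfl

@[simp] lemma of_inj {f g : a ⟶ b} {α β : f ⟶ g} : of α = of β ↔ α = β := by simp [of]

/-- The way back from bundled to typed 2-cells, once the boundary is known. -/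
lemma exists_of_eq (X : TwoCell a b) {f g : a ⟶ b} (h₁ : X.dom = f) (h₂ : X.cod = g) :
    ∃ α : f ⟶ g, of α = X := by
  subst h₁ h₂; exact ⟨X.hom, rfl⟩

@[simp] lemma of_eqToHom {f g : a ⟶ b} (h : f = g) : of (eqToHom h) = one f := by
  subst h; rfl

@[simp] lemma of_eqToHom_comp {f g h : a ⟶ b} (e : f = g) (α : g ⟶ h) :
    of (eqToHom e ≫ α) = of α := by
  subst e; simp

@[simp] lemma of_comp_eqToHom {f g h : a ⟶ b} (e : g = h) (α : f ⟶ g) :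
    of (α ≫ eqToHom e) = of α := by
  subst e; simp

lemma of_comp {f g h : a ⟶ b} (α : f ⟶ g) (β : g ⟶ h) :
    of (α ≫ β) = comp (of α) (of β) rfl := by
  change of _ = of (α ≫ eqToHom rfl ≫ β)
  simp

@[simp] lemma wl_of (f : a ⟶ b) {g h : b ⟶ c} (α : g ⟶ h) : wl f (of α) = of (f ◁ α) := rfl
@[simp] lemma wr_of {g h : a ⟶ b} (α : g ⟶ h) (f : b ⟶ c) : wr (of α) f = of (α ▷ f) := rfl

@[simp] lemma wl_one (f : a ⟶ b) (g : b ⟶ c) : wl f (one g) = one (f ≫ g) := by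
  simp [wl, one]

@[simp] lemma wr_one (f : a ⟶ b) (g : b ⟶ c) : wr (one f) g = one (f ≫ g) := by
  simp [wr, one]

lemma comp_congr {X X' Y Y' : TwoCell a b} (h₁ : X = X') (h₂ : Y = Y') (h : X.cod = Y.dom) :
    comp X Y h = comp X' Y' (h₁ ▸ h₂ ▸ h) := by
  subst h₁ h₂; rfl

@[simp] lemma one_comp (f : a ⟶ b) (Y : TwoCell a b) (h : (one f).cod = Y.dom) :
    comp (one f) Y h = Y := by
  cases Y; cases h; simp [comp, one]

@[simp] lemma comp_one (X : TwoCell a b) (f : a ⟶ b) (h : X.cod = (one f).dom) :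
    comp X (one f) h = X := by
  cases X; cases h; simp [comp, one]

lemma comp_assoc (X Y Z : TwoCell a b) (h : X.cod = Y.dom) (h' : Y.cod = Z.dom) :
    comp (comp X Y h) Z h' = comp X (comp Y Z h') h := by
  simp [comp]

lemma wl_comp (f : a ⟶ b) (X Y : TwoCell b c) (h : X.cod = Y.dom) :
    wl f (comp X Y h) = comp (wl f X) (wl f Y) (congrArg (f ≫ ·) h) := by
  cases X; cases Y; cases h; simp [comp, wl]

lemma wr_comp (X Y : TwoCell a b) (h : X.cod = Y.dom) (f : b ⟶ c) :
    wr (comp X Y h) f = comp (wr X f) (wr Y f) (congrArg (· ≫ f) h) := by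
  cases X; cases Y; cases h; simp [comp, wr]

lemma inv_wl {X : TwoCell b c} (h : X.Inv) (f : a ⟶ b) : (wl f X).Inv := by
  have : IsIso X.hom := h
  exact inferInstanceAs (IsIso (f ◁ X.hom))

lemma inv_wr {X : TwoCell a b} (h : X.Inv) (f : b ⟶ c) : (wr X f).Inv := by
  have : IsIso X.hom := h
  exact inferInstanceAs (IsIso (X.hom ▷ f))

lemma inv_comp {X Y : TwoCell a b} (hX : X.Inv) (hY : Y.Inv) (h : X.cod = Y.dom) :
    (comp X Y h).Inv := by
  have : IsIso X.hom := hX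
  have : IsIso Y.hom := hY
  exact inferInstanceAs (IsIso (X.hom ≫ eqToHom h ≫ Y.hom))

lemma inv_one (f : a ⟶ b) : (one f).Inv := inferInstanceAs (IsIso (𝟙 f))

lemma exists_inverse {X : TwoCell a b} (h : X.Inv) :
    ∃ (Y : TwoCell a b) (h₁ : X.cod = Y.dom) (h₂ : Y.cod = X.dom),
      comp X Y h₁ = one X.dom ∧ comp Y X h₂ = one X.cod := by
  have : IsIso X.hom := h
  exact ⟨⟨_, _, CategoryTheory.inv X.hom⟩, rfl, rfl, by simp [comp, one],
    by simp [comp, one]⟩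

/-- Undoes a conjugation. In the pseudo case `N` comes from an arbitrary 2-cell, while its conjugate
has tight boundary. -/
lemma comp_comp_cancel {L L' N M M' : TwoCell a b} (h₁ : L.cod = N.dom) (h₂ : N.cod = M'.dom)
    (h₃ : L'.cod = L.dom) (h₄ : M'.cod = M.dom) (eL : comp L' L h₃ = one L.cod)
    (eM : comp M' M h₄ = one M'.dom) :
    comp (comp L' (comp (comp L N h₁) M' h₂) h₃) M h₄ = N := by
  refine (comp_congr (comp_congr rfl (comp_assoc L N M' h₁ h₂) h₃) rfl h₄).trans ?_
  refine (comp_congr (comp_assoc L' L (comp N M' h₂) h₃ h₁).symm rfl h₄).trans ?_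
  refine (comp_congr (comp_congr eL (rfl : comp N M' h₂ = _) h₁) (rfl : M = M) h₄).trans ?_
  refine (comp_congr (one_comp L.cod (comp N M' h₂) h₁) rfl h₄).trans ?_
  exact (comp_assoc N M' M h₂ h₄).trans ((comp_congr rfl eM h₂).trans (comp_one N M'.dom h₂))

lemma inverse_unique {X Y Y' : TwoCell a b} (h : Y.cod = X.dom) (h' : X.cod = Y'.dom)
    (e : comp Y X h = one X.cod) (e' : comp X Y' h' = one X.dom) : Y = Y' := by
  have h₁ := comp_assoc Y X Y' h h'
  have h₂ := comp_congr e (rfl : Y' = Y') h'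
  have h₃ := comp_congr (rfl : Y = Y) e' h
  rw [one_comp] at h₂
  rw [comp_one] at h₃
  exact h₃.symm.trans (h₁.symm.trans h₂)

end

section Strict

variable {A : Type u} [Bicategory.{w, v} A] [Bicategory.Strict A] {a b c d : A}

@[simp] lemma wl_id (X : TwoCell a b) : wl (𝟙 a) X = X := by
  obtain ⟨f, g, α⟩ := X
  change of (𝟙 a ◁ α) = of α
  simp [Strict.leftUnitor_eqToIso]

lemma wl_wl (f : a ⟶ b) (g : b ⟶ c) (X : TwoCell c d) : wl f (wl g X) = wl (f ≫ g) X := by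
  obtain ⟨h, k, α⟩ := X
  change of (f ◁ g ◁ α) = of ((f ≫ g) ◁ α)
  simp [Strict.associator_eqToIso]

lemma wr_wr (X : TwoCell a b) (f : b ⟶ c) (g : c ⟶ d) : wr (wr X f) g = wr X (f ≫ g) := by
  obtain ⟨h, k, α⟩ := X
  change of ((α ▷ f) ▷ g) = of (α ▷ (f ≫ g))
  simp [Strict.associator_eqToIso]

lemma wr_wl (f : a ⟶ b) (X : TwoCell b c) (g : c ⟶ d) : wr (wl f X) g = wl f (wr X g) := by
  obtain ⟨h, k, α⟩ := X
  change of ((f ◁ α) ▷ g) = of (f ◁ (α ▷ g))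
  simp [Strict.associator_eqToIso]

end Strict

end TwoCell

/-! ### F-functors with a prescribed action on objects -/

/-- An F-functor whose action on objects is the given function `o`. -/
structure FFunctorOn (A : Type u₁) [FCategory.{w₁, v₁} A] (B : Type u₂) [FCategory.{w₂, v₂} B]
    (o : A → B) where
  map : ∀ {a b : A}, (a ⟶ b) → (o a ⟶ o b)
  cell : ∀ {a b : A} {f g : a ⟶ b}, (f ⟶ g) → (map f ⟶ map g)
  map_id : ∀ a : A, map (𝟙 a) = 𝟙 (o a)
  map_comp : ∀ {a b c : A} (f : a ⟶ b) (g : b ⟶ c), map (f ≫ g) = map f ≫ map g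
  cell_id : ∀ {a b : A} (f : a ⟶ b), cell (𝟙 f) = 𝟙 (map f)
  cell_comp : ∀ {a b : A} {f g h : a ⟶ b} (α : f ⟶ g) (β : g ⟶ h),
    cell (α ≫ β) = cell α ≫ cell β
  cell_whiskerLeft : ∀ {a b c : A} (f : a ⟶ b) {g h : b ⟶ c} (α : g ⟶ h),
    TwoCell.of (cell (f ◁ α)) = (TwoCell.of (cell α)).wl (map f)
  cell_whiskerRight : ∀ {a b c : A} {g h : a ⟶ b} (α : g ⟶ h) (f : b ⟶ c),
    TwoCell.of (cell (α ▷ f)) = (TwoCell.of (cell α)).wr (map f)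
  map_tight : ∀ {a b : A} (f : a ⟶ b), IsTight f → IsTight (map f)

namespace FFunctorOn

variable {A : Type u₁} [FCategory.{w₁, v₁} A] {B : Type u₂} [FCategory.{w₂, v₂} B]
  {C : Type u₃} [FCategory.{w₃, v₃} C] {o : A → B} {a b c : A}

/-- The action on bundled 2-cells. -/
def mapCell (F : FFunctorOn A B o) (X : TwoCell a b) : TwoCell (o a) (o b) :=
  ⟨F.map X.dom, F.map X.cod, F.cell X.hom⟩

section

variable (F : FFunctorOn A B o)

@[simp] lemma mapCell_dom (X : TwoCell a b) : (F.mapCell X).dom = F.map X.dom := rfl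
@[simp] lemma mapCell_cod (X : TwoCell a b) : (F.mapCell X).cod = F.map X.cod := rfl

@[simp] lemma mapCell_one (f : a ⟶ b) : F.mapCell (.one f) = .one (F.map f) := by
  simp [mapCell, TwoCell.one, F.cell_id]

@[simp] lemma mapCell_wl (f : a ⟶ b) (X : TwoCell b c) :
    F.mapCell (X.wl f) = (F.mapCell X).wl (F.map f) :=
  F.cell_whiskerLeft f X.hom

@[simp] lemma mapCell_wr (X : TwoCell a b) (f : b ⟶ c) :
    F.mapCell (X.wr f) = (F.mapCell X).wr (F.map f) :=
  F.cell_whiskerRight X.hom f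

@[simp] lemma mapCell_comp (X Y : TwoCell a b) (h : X.cod = Y.dom) :
    F.mapCell (X.comp Y h) = (F.mapCell X).comp (F.mapCell Y) (congrArg F.map h) := by
  obtain ⟨f, g, α⟩ := X
  obtain ⟨g', h, β⟩ := Y
  cases h
  simp [mapCell, TwoCell.comp, F.cell_comp]

lemma inv_mapCell {X : TwoCell a b} (h : X.Inv) : (F.mapCell X).Inv := by
  obtain ⟨f, g, α⟩ := X
  have : IsIso α := h
  exact ⟨F.cell (inv α), (F.cell_comp _ _).symm.trans (by rw [IsIso.hom_inv_id, F.cell_id]; rfl),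
    (F.cell_comp _ _).symm.trans (by rw [IsIso.inv_hom_id, F.cell_id]; rfl)⟩

end

/-- The F-functor underlying an F-functor with prescribed action on objects. -/
def toFFunctor (F : FFunctorOn A B o) : FFunctor A B where
  toStrictPseudofunctor := StrictPseudofunctor.mk''
    { obj := o
      map := F.map
      map₂ := F.cell
      map₂_id := F.cell_id
      map₂_comp := F.cell_comp
      map_id := F.map_id
      map_comp := F.map_comp
      map₂_whisker_left := fun f _ _ η => by
        rw [← TwoCell.of_inj]
        simp [F.cell_whiskerLeft f η]
      map₂_whisker_right := fun η g => by
        rw [← TwoCell.of_inj]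
        simp [F.cell_whiskerRight η g] }
  map_tight := F.map_tight

end FFunctorOn

namespace FFunctor

variable {A : Type u₁} [FCategory.{w₁, v₁} A] {B : Type u₂} [FCategory.{w₂, v₂} B]
  {C : Type u₃} [FCategory.{w₃, v₃} C]

/-- An F-functor as an F-functor with its own action on objects. -/
def toOn (F : FFunctor A B) : FFunctorOn A B F.obj where
  map := F.map
  cell := F.map₂
  map_id := F.map_id
  map_comp := F.map_comp
  cell_id := F.map₂_id
  cell_comp := F.map₂_comp
  cell_whiskerLeft f _ _ α := by simp [F.mapComp_eq_eqToIso]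
  cell_whiskerRight α f := by simp [F.mapComp_eq_eqToIso]
  map_tight := F.map_tight

/-- Strictness makes the coherence isomorphisms equal to `eqToIso`, so they carry no information. -/
lemma ext_of_prelax {F G : FFunctor A B} (h : F.toPrelaxFunctor = G.toPrelaxFunctor) :
    F = G := by
  obtain ⟨⟨⟨⟨F, i, j, _, _, _, _, _⟩, hF, k⟩, hF', l⟩, _⟩ := F
  obtain ⟨⟨⟨⟨G, i', j', _, _, _, _, _⟩, hG, k'⟩, hG', l'⟩, _⟩ := G
  obtain rfl : F = G := h
  obtain rfl : @i = @i' := by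
    funext a; exact (k a).trans (k' a).symm
  obtain rfl : @j = @j' := by
    funext a b c f g; exact (l f g).trans (l' f g).symm
  rfl

lemma toFFunctor_toOn (F : FFunctor A B) : F.toOn.toFFunctor = F := ext_of_prelax rfl

/-- Equality of object maps is eliminated here once and for all, so that later comparisons of
F-functors involve no transport. -/
lemma exists_on (F : FFunctor A B) {o : A → B} (h : F.obj = o) :
    ∃ G : FFunctorOn A B o, G.toFFunctor = F := by
  subst h
  exact ⟨F.toOn, F.toFFunctor_toOn⟩

end FFunctor

namespace FFunctorOn

variable {A : Type u₁} [FCategory.{w₁, v₁} A] {B : Type u₂} [FCategory.{w₂, v₂} B]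
  {C : Type u₃} [FCategory.{w₃, v₃} C] {o : A → B}

lemma toFFunctor_inj {F G : FFunctorOn A B o} (h : F.toFFunctor = G.toFFunctor) : F = G := by
  cases F
  cases G
  simp only [toFFunctor, StrictPseudofunctor.mk'', FFunctor.mk.injEq,
    StrictPseudofunctor.mk.injEq, StrictlyUnitaryPseudofunctor.mk.injEq, Pseudofunctor.mk.injEq,
    PrelaxFunctor.mk.injEq, PrelaxFunctorStruct.mk.injEq] at h
  grind

/-- A bundled 2-cell remembers its boundary, so evaluating at identity 2-cells already gives
agreement on 1-cells. -/
lemma ext_of_mapCell {F G : FFunctorOn A B o}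
    (h₂ : ∀ {a b : A} (X : TwoCell a b), F.mapCell X = G.mapCell X) : F = G := by
  have h₁ : ∀ {a b : A} (f : a ⟶ b), F.map f = G.map f := fun f =>
    congrArg TwoCell.dom (h₂ (.one f))
  obtain ⟨m, c, _⟩ := F
  obtain ⟨m', c', _⟩ := G
  obtain rfl : @m = @m' := by
    funext a b f; exact h₁ f
  obtain rfl : @c = @c' := by
    funext a b f g α
    exact TwoCell.of_inj.1 (h₂ (.of α))
  rfl

end FFunctorOn

/-! ### Reflections, equationally -/

section

variable {A : Type u₁} [FCategory.{w₁, v₁} A] {B : Type u₂} [FCategory.{w₂, v₂} B]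
  {C : Type u₃} [FCategory.{w₃, v₃} C] {P : Prop} {a b c : A}

/-- `g` and the 2-cell `X` exhibit `e` as the left adjoint of a reflection, whose unit `X` is
invertible in case `P` holds. -/
structure IsReflection (P : Prop) (e : a ⟶ b) (g : b ⟶ a) (X : TwoCell a a) : Prop where
  tight : IsTight e
  dom_eq : X.dom = 𝟙 a
  cod_eq : X.cod = e ≫ g
  right_comp : g ≫ e = 𝟙 b
  wr_eq : X.wr e = .one e
  wl_eq : X.wl g = .one g
  inv : P → X.Inv

namespace LReflection

variable {f : a ⟶ b}

/-- As the counit is an identity, the triangle identities collapse to the statements that the unit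
becomes an identity when whiskered by either adjoint. -/
lemma isReflection (ρ : LReflection f) (h : P → ρ.IsPseudo) :
    IsReflection P f ρ.right (.of ρ.adj.unit) where
  tight := ρ.tight
  dom_eq := rfl
  cod_eq := rfl
  right_comp := ρ.right_comp
  wr_eq := by
    have := congrArg TwoCell.of ρ.adj.left_triangle
    simpa [bicategoricalComp, ρ.counit_eq, Strict.leftUnitor_eqToIso, Strict.rightUnitor_eqToIso,
      Strict.associator_eqToIso] using this
  wl_eq := by
    have := congrArg TwoCell.of ρ.adj.right_triangle
    simpa [bicategoricalComp, ρ.counit_eq, Strict.leftUnitor_eqToIso, Strict.rightUnitor_eqToIso,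
      Strict.associator_eqToIso] using this
  inv := h

lemma ext_of_unit {ρ σ : LReflection f} (h₁ : ρ.right = σ.right)
    (h₂ : TwoCell.of ρ.adj.unit = TwoCell.of σ.adj.unit) : ρ = σ := by
  obtain ⟨g, ⟨η, k, _, _⟩, _, _, hk⟩ := ρ
  obtain ⟨g', ⟨η', k', _, _⟩, _, _, hk'⟩ := σ
  obtain rfl : g = g' := h₁
  obtain rfl : η = η' := TwoCell.of_inj.1 h₂
  obtain rfl : k = k' := Eq.trans hk hk'.symm
  rfl

lemma isMorphism_iff {d : A} {f₁ : a ⟶ b} {f₂ : c ⟶ d} (ρ₁ : LReflection f₁)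
    (ρ₂ : LReflection f₂) (r : a ⟶ c) (s : b ⟶ d) (sq : r ≫ f₂ = f₁ ≫ s) :
    ρ₁.IsMorphism ρ₂ r s sq ↔ s ≫ ρ₂.right = ρ₁.right ≫ r ∧
      (TwoCell.of ρ₁.adj.unit).wr r = (TwoCell.of ρ₂.adj.unit).wl r := by
  simp only [IsMorphism, ← TwoCell.of_inj]
  simp [Strict.leftUnitor_eqToIso, Strict.rightUnitor_eqToIso]

end LReflection

namespace IsReflection

variable {e : a ⟶ b} {g : b ⟶ a} {X : TwoCell a a}

lemma exists_lReflection (h : IsReflection P e g X) :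
    ∃ ρ : LReflection e, ρ.right = g ∧ TwoCell.of ρ.adj.unit = X := by
  obtain ⟨η, rfl⟩ := X.exists_of_eq h.dom_eq h.cod_eq
  have h₁ := h.wr_eq
  have h₂ := h.wl_eq
  refine ⟨⟨g, ⟨η, eqToHom h.right_comp, ?_, ?_⟩, h.tight, h.right_comp, rfl⟩, rfl, rfl⟩
  · rw [← TwoCell.of_inj]
    simpa [bicategoricalComp, Strict.leftUnitor_eqToIso, Strict.rightUnitor_eqToIso,
      Strict.associator_eqToIso] using h₁
  · rw [← TwoCell.of_inj]
    simpa [bicategoricalComp, Strict.leftUnitor_eqToIso, Strict.rightUnitor_eqToIso,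
      Strict.associator_eqToIso] using h₂

lemma map {o : A → B} (F : FFunctorOn A B o) (h : IsReflection P e g X) :
    IsReflection P (F.map e) (F.map g) (F.mapCell X) where
  tight := F.map_tight _ h.tight
  dom_eq := by simp [h.dom_eq, F.map_id]
  cod_eq := by simp [h.cod_eq, F.map_comp]
  right_comp := by rw [← F.map_comp, h.right_comp, F.map_id]
  wr_eq := by rw [← F.mapCell_wr, h.wr_eq, F.mapCell_one]
  wl_eq := by rw [← F.mapCell_wl, h.wl_eq, F.mapCell_one]
  inv hP := F.inv_mapCell (h.inv hP)

variable (P a) in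
lemma id : IsReflection P (𝟙 a) (𝟙 a) (.one (𝟙 a)) where
  tight := tight_id a
  dom_eq := rfl
  cod_eq := (Strict.id_comp _).symm
  right_comp := Strict.id_comp _
  wr_eq := by simp
  wl_eq := by simp
  inv _ := TwoCell.inv_one _

variable {e' : b ⟶ c} {g' : c ⟶ b} {X' : TwoCell b b}

lemma comp_unit_eq (h : IsReflection P e g X) (h' : IsReflection P e' g' X') :
    X.cod = ((X'.wl e).wr g).dom := by
  simp [h.cod_eq, h'.dom_eq]

/-- The usual composite adjunction; each whiskering of its unit by an adjoint is a composite of two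
identities. -/
lemma comp (h : IsReflection P e g X) (h' : IsReflection P e' g' X') :
    IsReflection P (e ≫ e') (g' ≫ g) (X.comp ((X'.wl e).wr g) (h.comp_unit_eq h')) where
  tight := tight_comp _ _ h.tight h'.tight
  dom_eq := h.dom_eq
  cod_eq := by simp [h'.cod_eq]
  right_comp := by
    rw [Strict.assoc, ← Strict.assoc g, h.right_comp, Strict.id_comp, h'.right_comp]
  wr_eq := by
    rw [TwoCell.wr_comp]
    refine (TwoCell.comp_congr (X' := .one (e ≫ e')) (Y' := .one (e ≫ e')) ?_ ?_ _).trans (by simp)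
    · rw [← TwoCell.wr_wr, h.wr_eq, TwoCell.wr_one]
    · rw [TwoCell.wr_wr, ← Strict.assoc, h.right_comp, Strict.id_comp, TwoCell.wr_wl, h'.wr_eq,
        TwoCell.wl_one]
  wl_eq := by
    rw [TwoCell.wl_comp]
    refine (TwoCell.comp_congr (X' := .one (g' ≫ g)) (Y' := .one (g' ≫ g)) ?_ ?_ _).trans (by simp)
    · rw [← TwoCell.wl_wl, h.wl_eq, TwoCell.wl_one]
    · rw [← TwoCell.wr_wl, TwoCell.wl_wl, Strict.assoc, h.right_comp, Strict.comp_id, h'.wl_eq,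
        TwoCell.wr_one]
  inv hP := TwoCell.inv_comp (h.inv hP) (TwoCell.inv_wr (TwoCell.inv_wl (h'.inv hP) _) _) _

end IsReflection

/-! ### Doctrinal conditions, equationally -/

namespace FFunctorOn

variable {o : A → B}

/-- Reflections lift uniquely along `H`, for a given tight left adjoint. -/
def LiftsReflections (P : Prop) (H : FFunctorOn A B o) : Prop :=
  ∀ ⦃a b : A⦄ (e : a ⟶ b), IsTight e → ∀ g X, IsReflection P (H.map e) g X →
    ∃! r : (b ⟶ a) × TwoCell a a,
      IsReflection P e r.1 r.2 ∧ H.map r.1 = g ∧ H.mapCell r.2 = X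

/-- Tight squares whose image under `H` is a morphism of reflections commute with the right
adjoints. -/
def ReflectsMorphisms (P : Prop) (H : FFunctorOn A B o) : Prop :=
  ∀ ⦃a b c d : A⦄ ⦃e₁ : a ⟶ b⦄ ⦃e₂ : c ⟶ d⦄ ⦃g₁ g₂ X₁ X₂⦄, IsReflection P e₁ g₁ X₁ →
    IsReflection P e₂ g₂ X₂ → ∀ (r : a ⟶ c) (s : b ⟶ d), IsTight r → IsTight s →
      r ≫ e₂ = e₁ ≫ s → H.map s ≫ H.map g₂ = H.map g₁ ≫ H.map r →
      (H.mapCell X₁).wr (H.map r) = (H.mapCell X₂).wl (H.map r) → s ≫ g₂ = g₁ ≫ r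

/-- `H` is injective on parallel 2-cells. -/
def Faithful₂ (H : FFunctorOn A B o) : Prop :=
  ∀ ⦃a b : A⦄ (X Y : TwoCell a b), X.dom = Y.dom → X.cod = Y.cod →
    H.mapCell X = H.mapCell Y → X = Y

end FFunctorOn

namespace FFunctor

variable {H : FFunctor A B}

lemma unit_map {f : a ⟶ b} (ρ : LReflection f) :
    TwoCell.of (ρ.map H).adj.unit = H.toOn.mapCell (.of ρ.adj.unit) := by
  have : (ρ.map H).adj.unit = _ := H.toStrictPseudofunctor.mapAdjunction_unit' ρ.adj
  exact (congrArg TwoCell.of this).trans ((TwoCell.of_eqToHom_comp _ _).trans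
    (TwoCell.of_comp_eqToHom _ _))

lemma LRefl.liftsReflections (h : H.LRefl) : H.toOn.LiftsReflections False := by
  intro a b e he g X hX
  obtain ⟨σ, rfl, rfl⟩ := hX.exists_lReflection
  obtain ⟨ρ, rfl, hu⟩ := h e he σ
  refine ⟨(ρ.right, .of ρ.adj.unit), ⟨ρ.isReflection False.elim, rfl, (unit_map ρ).symm⟩, ?_⟩
  rintro ⟨g, X⟩ ⟨h₁, h₂, h₃⟩
  obtain ⟨ρ', rfl, rfl⟩ := h₁.exists_lReflection
  obtain rfl := hu ρ' (LReflection.ext_of_unit h₂ ((unit_map ρ').trans h₃))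
  rfl

lemma PRefl.liftsReflections (h : H.PRefl) : H.toOn.LiftsReflections True := by
  intro a b e he g X hX
  obtain ⟨σ, rfl, rfl⟩ := hX.exists_lReflection
  obtain ⟨ρ, ⟨hρ, rfl⟩, hu⟩ := h e he σ (hX.inv trivial)
  refine ⟨(ρ.right, .of ρ.adj.unit), ⟨ρ.isReflection fun _ => hρ, rfl, (unit_map ρ).symm⟩, ?_⟩
  rintro ⟨g, X⟩ ⟨h₁, h₂, h₃⟩
  obtain ⟨ρ', rfl, rfl⟩ := h₁.exists_lReflection
  obtain rfl := hu ρ' ⟨h₁.inv trivial, LReflection.ext_of_unit h₂ ((unit_map ρ').trans h₃)⟩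
  rfl

lemma LMorph.reflectsMorphisms (h : H.LMorph) : H.toOn.ReflectsMorphisms False := by
  intro a b c d e₁ e₂ g₁ g₂ X₁ X₂ h₁ h₂ r s hr hs sq hg hX
  obtain ⟨ρ₁, rfl, rfl⟩ := h₁.exists_lReflection
  obtain ⟨ρ₂, rfl, rfl⟩ := h₂.exists_lReflection
  refine ((LReflection.isMorphism_iff _ _ _ _ sq).1 ((h ρ₁ ρ₂ r s hr hs sq).2
    ((LReflection.isMorphism_iff _ _ _ _ _).2 ⟨hg, ?_⟩))).1
  rw [unit_map, unit_map]
  exact hX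

lemma PMorph.reflectsMorphisms (h : H.PMorph) : H.toOn.ReflectsMorphisms True := by
  intro a b c d e₁ e₂ g₁ g₂ X₁ X₂ h₁ h₂ r s hr hs sq hg hX
  obtain ⟨ρ₁, rfl, rfl⟩ := h₁.exists_lReflection
  obtain ⟨ρ₂, rfl, rfl⟩ := h₂.exists_lReflection
  refine ((LReflection.isMorphism_iff _ _ _ _ sq).1
    ((h ρ₁ ρ₂ (h₁.inv trivial) (h₂.inv trivial) r s hr hs sq).2
      ((LReflection.isMorphism_iff _ _ _ _ _).2 ⟨hg, ?_⟩))).1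
  rw [unit_map, unit_map]
  exact hX

lemma LocallyFaithful.faithful₂ (h : H.LocallyFaithful) : H.toOn.Faithful₂ := by
  rintro a b ⟨f, g, α⟩ ⟨f', g', β⟩ h₁ h₂ e
  cases h₁
  cases h₂
  exact congrArg _ (h α β (TwoCell.of_inj.1 e))

end FFunctor

/-! ### Limits of loose morphisms, equationally -/

/-- The equational form of a limit of a loose morphism `f`: a tight span `p, q` such that `p` is
the left adjoint of a reflection with right adjoint `r` and unit `X`, for which `r ≫ q = f` and the
limit cone is `X` whiskered by `q`. -/
structure IsLooseLimit (P : Prop) {l : A} (f : a ⟶ b) (p : l ⟶ a) (q : l ⟶ b) (r : a ⟶ l)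
    (X : TwoCell l l) : Prop where
  refl : IsReflection P p r X
  tight : IsTight q
  fac : r ≫ q = f
  exists_lift : ∀ ⦃x : A⦄ (u : x ⟶ a) (v : x ⟶ b) (Y : TwoCell x b), Y.dom = v →
    Y.cod = u ≫ f → (P → Y.Inv) → ∃ t : x ⟶ l, t ≫ p = u ∧ t ≫ q = v ∧ (X.wr q).wl t = Y
  hom_ext : ∀ ⦃x : A⦄ (t t' : x ⟶ l), t ≫ p = t' ≫ p → t ≫ q = t' ≫ q →
    (X.wr q).wl t = (X.wr q).wl t' → t = t'
  tight_of : ∀ ⦃x : A⦄ (t : x ⟶ l), IsTight (t ≫ p) → IsTight (t ≫ q) → IsTight t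
  cell_ext : ∀ ⦃x : A⦄ (Y Y' : TwoCell x l), Y.dom = Y'.dom → Y.cod = Y'.cod →
    Y.wr p = Y'.wr p → Y.wr q = Y'.wr q → Y = Y'

namespace ColaxCone

variable {f : a ⟶ b} {l x : A}

lemma ext_of_cell {c d : ColaxCone f x} (hp : c.p = d.p) (hq : c.q = d.q)
    (h : TwoCell.of c.cell = TwoCell.of d.cell) : c = d := by
  obtain ⟨p, q, α⟩ := c
  obtain ⟨p', q', β⟩ := d
  cases hp
  cases hq
  cases TwoCell.of_inj.1 h
  rfl

lemma of_precomp_cell (c : ColaxCone f l) (t : x ⟶ l) :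
    TwoCell.of (c.precomp t).cell = (TwoCell.of c.cell).wl t := by
  simp [precomp, Strict.associator_eqToIso]

lemma TwoDimUniversal.existsUnique {c : ColaxCone f l} (h : c.TwoDimUniversal) {t t' : x ⟶ l}
    (θp : t ≫ c.p ⟶ t' ≫ c.p) (θq : t ≫ c.q ⟶ t' ≫ c.q)
    (e : θq ≫ t' ◁ c.cell ≫ (α_ t' c.p f).inv = t ◁ c.cell ≫ (α_ t c.p f).inv ≫ θp ▷ f) :
    ∃! φ : t ⟶ t', φ ▷ c.p = θp ∧ φ ▷ c.q = θq :=
  h t t' θp θq (e.trans (Category.assoc _ _ _).symm)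

/-- An instance of interchange: the two whiskerings of any `φ` satisfy the compatibility required by
the 2-dimensional universal property, whose uniqueness clause therefore applies to them. -/
lemma whiskerRight_naturality (c : ColaxCone f l) {t t' : x ⟶ l} (φ : t ⟶ t') :
    φ ▷ c.q ≫ t' ◁ c.cell ≫ (α_ t' c.p f).inv =
      t ◁ c.cell ≫ (α_ t c.p f).inv ≫ (φ ▷ c.p) ▷ f := by
  simp [← whisker_exchange_assoc]

lemma TwoDimUniversal.cell_ext {c : ColaxCone f l} (h : c.TwoDimUniversal) (Y Y' : TwoCell x l)
    (h₁ : Y.dom = Y'.dom) (h₂ : Y.cod = Y'.cod) (hp : Y.wr c.p = Y'.wr c.p)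
    (hq : Y.wr c.q = Y'.wr c.q) : Y = Y' := by
  obtain ⟨t, t', φ⟩ := Y
  obtain ⟨s, s', ψ⟩ := Y'
  cases h₁
  cases h₂
  exact congrArg _ ((h.existsUnique (φ ▷ c.p) (φ ▷ c.q) (c.whiskerRight_naturality φ)).unique
    ⟨rfl, rfl⟩ ⟨(TwoCell.of_inj.1 hp).symm, (TwoCell.of_inj.1 hq).symm⟩)

/-- The inverses of the two whiskerings are again compatible, hence induce a 2-cell; it is inverse
to `φ` because it is so after both projections. -/
lemma TwoDimUniversal.isIso {c : ColaxCone f l} (h : c.TwoDimUniversal) {t t' : x ⟶ l}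
    (φ : t ⟶ t') (hp : IsIso (φ ▷ c.p)) (hq : IsIso (φ ▷ c.q)) : IsIso φ := by
  obtain ⟨ψ, ⟨h₁, h₂⟩, -⟩ := h.existsUnique (inv (φ ▷ c.p)) (inv (φ ▷ c.q)) (by
    have := congrArg (· ≫ inv (φ ▷ c.p) ▷ f) (c.whiskerRight_naturality φ)
    simp only [Category.assoc, ← comp_whiskerRight, IsIso.hom_inv_id, id_whiskerRight,
      Category.comp_id] at this
    rw [IsIso.inv_comp_eq]
    exact this.symm)
  refine ⟨ψ, ?_, ?_⟩
  · refine TwoCell.of_inj.1 (h.cell_ext _ _ rfl rfl ?_ ?_)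
    · simp only [TwoCell.wr_of, comp_whiskerRight, h₁, IsIso.hom_inv_id, id_whiskerRight]
    · simp only [TwoCell.wr_of, comp_whiskerRight, h₂, IsIso.hom_inv_id, id_whiskerRight]
  · refine TwoCell.of_inj.1 (h.cell_ext _ _ rfl rfl ?_ ?_)
    · simp only [TwoCell.wr_of, comp_whiskerRight, h₁, IsIso.inv_hom_id, id_whiskerRight]
    · simp only [TwoCell.wr_of, comp_whiskerRight, h₂, IsIso.inv_hom_id, id_whiskerRight]

/-- The source of the factorisation: a limit cone is the unit of a reflection, seen through `q`. -/
lemma exists_isLooseLimit (c : ColaxCone f l) (hP : P → c.IsPseudo)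
    (h₁ : ∀ ⦃x : A⦄ (d : ColaxCone f x), (P → d.IsPseudo) → ∃! t : x ⟶ l, c.precomp t = d)
    (h₂ : c.TwoDimUniversal) (h₃ : c.DetectsTight) :
    ∃ r X, IsLooseLimit P f c.p c.q r X := by
  have lift : ∀ ⦃x : A⦄ (u : x ⟶ a) (v : x ⟶ b) (Y : TwoCell x b), Y.dom = v → Y.cod = u ≫ f →
      (P → Y.Inv) → ∃ t : x ⟶ l, t ≫ c.p = u ∧ t ≫ c.q = v ∧ (TwoCell.of c.cell).wl t = Y := by
    intro x u v Y e₁ e₂ hY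
    obtain ⟨α, rfl⟩ := Y.exists_of_eq e₁ e₂
    obtain ⟨t, ht, -⟩ := h₁ ⟨u, v, α⟩ hY
    have hc := c.of_precomp_cell t
    rw [ht] at hc
    exact ⟨t, congrArg ColaxCone.p ht, congrArg ColaxCone.q ht, hc.symm⟩
  have ext : ∀ ⦃x : A⦄ (t t' : x ⟶ l), t ≫ c.p = t' ≫ c.p → t ≫ c.q = t' ≫ c.q →
      (TwoCell.of c.cell).wl t = (TwoCell.of c.cell).wl t' → t = t' := by
    intro x t t' e₁ e₂ e₃
    refine (h₁ (c.precomp t') fun hp => ?_).unique (ext_of_cell e₁ e₂ ?_) rfl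
    · have : IsIso c.cell := hP hp
      exact inferInstanceAs (IsIso (t' ◁ c.cell ≫ (α_ t' c.p f).inv))
    · rw [of_precomp_cell, of_precomp_cell, e₃]
  -- The section `r` classifies the identity cone, which is invertible and so is admissible in the
  -- pseudo case too.
  obtain ⟨r, hp, hq, hr⟩ := lift (𝟙 a) f (.one f) rfl (Strict.id_comp f).symm
    fun _ => TwoCell.inv_one f
  have e₁ : 𝟙 l ≫ c.p = (c.p ≫ r) ≫ c.p := by
    rw [Strict.assoc, hp, Strict.comp_id, Strict.id_comp]
  have e₂ : c.p ≫ f = (c.p ≫ r) ≫ c.q := by rw [Strict.assoc, hq]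
  have e₃ : (c.p ≫ r) ≫ c.q = (c.p ≫ r) ≫ c.p ≫ f := by
    rw [Strict.assoc, hq, ← Strict.assoc _ c.p f, Strict.assoc c.p, hp, Strict.comp_id]
  have hc : (c.p ≫ r) ◁ c.cell = eqToHom e₃ := by
    rw [← TwoCell.of_inj, ← TwoCell.wl_of, ← TwoCell.wl_wl, hr, TwoCell.wl_one,
      TwoCell.of_eqToHom, e₂]
  -- The unit is the 2-cell `𝟙 l ⟶ c.p ≫ r` that is an identity after `c.p` and the limit cone after
  -- `c.q`; compatibility holds since the cone restricted along `c.p ≫ r` is an identity.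
  obtain ⟨η, ⟨hη, hη'⟩, -⟩ := h₂.existsUnique (t := 𝟙 l) (t' := c.p ≫ r) (eqToHom e₁)
    (eqToHom (Strict.id_comp c.q) ≫ c.cell ≫ eqToHom e₂) (by
      rw [hc, ← TwoCell.of_inj]
      simp [Strict.associator_eqToIso, Strict.leftUnitor_eqToIso])
  have wp : (TwoCell.of η).wr c.p = .one c.p := by
    rw [TwoCell.wr_of, hη, TwoCell.of_eqToHom, Strict.id_comp]
  have wq : (TwoCell.of η).wr c.q = .of c.cell := by
    rw [TwoCell.wr_of, hη', TwoCell.of_eqToHom_comp, TwoCell.of_comp_eqToHom]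
  refine ⟨r, .of η, ⟨⟨h₃.1, rfl, rfl, hp, wp, ?_, ?_⟩, h₃.2.1, hq, ?_, ?_,
    fun x t ht ht' => (h₃.2.2 t).2 ⟨ht, ht'⟩, fun x Y Y' => h₂.cell_ext Y Y'⟩⟩
  · refine h₂.cell_ext _ _ (Strict.comp_id r) ?_ ?_ ?_
    · rw [TwoCell.wl_cod, TwoCell.of_cod, ← Strict.assoc, hp, Strict.id_comp]; rfl
    · rw [TwoCell.wr_wl, wp]; simp
    · rw [TwoCell.wr_wl, wq, hr]; simp [hq]
  · intro h
    have : IsIso c.cell := hP h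
    refine h₂.isIso η ?_ ?_
    · rw [hη]; infer_instance
    · rw [hη']; infer_instance
  · rw [wq]; exact lift
  · rw [wq]; exact ext

end ColaxCone

/-- Every loose morphism has a limit in the equational form. -/
def HasLooseLimitsEq (P : Prop) (A : Type u₁) [FCategory.{w₁, v₁} A] : Prop :=
  ∀ ⦃a b : A⦄ (f : a ⟶ b), ∃ (l : A) (p : l ⟶ a) (q : l ⟶ b) (r : a ⟶ l) (X : TwoCell l l),
    IsLooseLimit P f p q r X

lemma HasColaxLimits.hasLooseLimitsEq (h : HasColaxLimits A) : HasLooseLimitsEq False A := by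
  intro a b f
  obtain ⟨l, c, hc⟩ := h f
  exact ⟨l, c.p, c.q, c.exists_isLooseLimit False.elim (fun x d _ => hc.1 d) hc.2 hc.3⟩

lemma HasPseudolimits.hasLooseLimitsEq (h : HasPseudolimits A) : HasLooseLimitsEq True A := by
  intro a b f
  obtain ⟨l, c, hc⟩ := h f
  exact ⟨l, c.p, c.q, c.exists_isLooseLimit (fun _ => hc.1) (fun x d hd => hc.2 d (hd trivial))
    hc.3 hc.4⟩

end

/-! ### The diagonal filler -/

section

variable {A : Type u₁} [FCategory.{w₁, v₁} A] {B : Type u₂} [FCategory.{w₂, v₂} B]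
  {C : Type u₃} [FCategory.{w₃, v₃} C] {P : Prop} {a b c : A} {oR : TightPart A → B} {oH : B → C}

/-- The action on a tight 1-cell of an F-functor defined on the tight part. -/
def FFunctorOn.mapTight (R : FFunctorOn (TightPart A) B oR) (f : a ⟶ b) (hf : IsTight f) :
    oR ⟨a⟩ ⟶ oR ⟨b⟩ :=
  R.map (a := ⟨a⟩) (b := ⟨b⟩) ⟨f, hf⟩

namespace FFunctorOn

variable (R : FFunctorOn (TightPart A) B oR)

lemma mapTight_id (a : A) : R.mapTight (𝟙 a) (tight_id a) = 𝟙 _ := R.map_id ⟨a⟩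

lemma mapTight_comp (f : a ⟶ b) (g : b ⟶ c) (hf : IsTight f) (hg : IsTight g) :
    R.mapTight f hf ≫ R.mapTight g hg = R.mapTight (f ≫ g) (tight_comp _ _ hf hg) :=
  (R.map_comp (a := ⟨a⟩) (b := ⟨b⟩) (c := ⟨c⟩) ⟨f, hf⟩ ⟨g, hg⟩).symm

lemma mapTight_congr {f g : a ⟶ b} (h : f = g) (hf : IsTight f) :
    R.mapTight f hf = R.mapTight g (h ▸ hf) := by
  subst h; rfl

lemma tight_mapTight (f : a ⟶ b) (hf : IsTight f) : IsTight (R.mapTight f hf) :=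
  R.map_tight _ trivial

end FFunctorOn

/-- A bundled 2-cell of the tight part, as a 2-cell of the ambient F-category. -/
def TwoCell.untight {X Y : TightPart A} (Z : TwoCell X Y) : TwoCell X.obj Y.obj :=
  ⟨Z.dom.hom, Z.cod.hom, TightPart.Hom₂.hom Z.hom⟩

/-- A commutative square from the inclusion of the tight part of `A` to `H`, in which `A` has limits
of loose morphisms and `H` is doctrinal. -/
structure DoctrinalSquare (P : Prop) (R : FFunctorOn (TightPart A) B oR) (H : FFunctorOn B C oH)
    (S : FFunctorOn A C fun X => oH (oR ⟨X⟩)) : Prop where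
  mapCell_eq : ∀ {X Y : TightPart A} (Z : TwoCell X Y),
    S.mapCell Z.untight = H.mapCell (R.mapCell Z)
  limits : HasLooseLimitsEq P A
  lifts : H.LiftsReflections P
  reflects : H.ReflectsMorphisms P
  faithful : H.Faithful₂

namespace DoctrinalSquare

variable {R : FFunctorOn (TightPart A) B oR} {H : FFunctorOn B C oH}
  {S : FFunctorOn A C fun X => oH (oR ⟨X⟩)} (sq : DoctrinalSquare P R H S)

include sq in
lemma map_eq (f : a ⟶ b) (hf : IsTight f) : H.map (R.mapTight f hf) = S.map f :=
  (congrArg TwoCell.dom (sq.mapCell_eq (X := ⟨a⟩) (Y := ⟨b⟩) (.one ⟨f, hf⟩))).symm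

/-! ### Lifting reflections and their morphisms -/

section Lift

variable {e : a ⟶ b} {g : b ⟶ a} {X : TwoCell a a}

include sq in
-- `S` preserves reflections, and the image of `e` is that of `R.mapTight e` under `H`, so Refl
-- applies.
lemma existsUnique_lift (h : IsReflection P e g X) :
    ∃! r : (oR ⟨b⟩ ⟶ oR ⟨a⟩) × TwoCell (oR ⟨a⟩) (oR ⟨a⟩),
      IsReflection P (R.mapTight e h.tight) r.1 r.2 ∧ H.map r.1 = S.map g ∧
        H.mapCell r.2 = S.mapCell X := by
  refine sq.lifts _ (R.tight_mapTight _ _) _ _ ?_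
  rw [sq.map_eq]
  exact h.map S

/-- The lift of a reflection of `A` to the domain of the doctrinal F-functor. -/
noncomputable def lift (h : IsReflection P e g X) :
    (oR ⟨b⟩ ⟶ oR ⟨a⟩) × TwoCell (oR ⟨a⟩) (oR ⟨a⟩) :=
  (sq.existsUnique_lift h).choose

lemma lift_refl (h : IsReflection P e g X) :
    IsReflection P (R.mapTight e h.tight) (sq.lift h).1 (sq.lift h).2 :=
  (sq.existsUnique_lift h).choose_spec.1.1

lemma map_lift (h : IsReflection P e g X) : H.map (sq.lift h).1 = S.map g :=
  (sq.existsUnique_lift h).choose_spec.1.2.1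

lemma mapCell_lift (h : IsReflection P e g X) : H.mapCell (sq.lift h).2 = S.mapCell X :=
  (sq.existsUnique_lift h).choose_spec.1.2.2

lemma eq_lift (h : IsReflection P e g X) {g' : oR ⟨b⟩ ⟶ oR ⟨a⟩}
    {X' : TwoCell (oR ⟨a⟩) (oR ⟨a⟩)} (h' : IsReflection P (R.mapTight e h.tight) g' X')
    (hg : H.map g' = S.map g) (hX : H.mapCell X' = S.mapCell X) : g' = (sq.lift h).1 :=
  congrArg Prod.fst ((sq.existsUnique_lift h).choose_spec.2 (g', X') ⟨h', hg, hX⟩)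

lemma lift_id (a : A) : (sq.lift (.id P a)).1 = 𝟙 _ := by
  refine (sq.eq_lift _ (X' := .one (𝟙 _)) ?_ ?_ ?_).symm
  · rw [R.mapTight_id]; exact .id P _
  · rw [H.map_id, S.map_id]
  · rw [H.mapCell_one, S.mapCell_one, H.map_id, S.map_id]

/-- The composite of the lifts is a reflection with the same image under `H`, so uniqueness of lifts
identifies the two. -/
lemma lift_comp {e' : b ⟶ c} {g' : c ⟶ b} {X' : TwoCell b b} (h : IsReflection P e g X)
    (h' : IsReflection P e' g' X') :
    (sq.lift (h.comp h')).1 = (sq.lift h').1 ≫ (sq.lift h).1 := by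
  refine (sq.eq_lift _ (X' := (sq.lift h).2.comp _
    ((sq.lift_refl h).comp_unit_eq (sq.lift_refl h'))) ?_ ?_ ?_).symm
  · rw [← R.mapTight_comp _ _ h.tight h'.tight]
    exact (sq.lift_refl h).comp (sq.lift_refl h')
  · rw [H.map_comp, S.map_comp, sq.map_lift, sq.map_lift]
  · rw [H.mapCell_comp, S.mapCell_comp]
    refine TwoCell.comp_congr (sq.mapCell_lift h) ?_ _
    rw [H.mapCell_wr, H.mapCell_wl, S.mapCell_wr, S.mapCell_wl, sq.mapCell_lift, sq.map_lift,
      sq.map_eq]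

/-- Lifting of a morphism of reflections into the reflection of a limit. -/
lemma lift_square {d l : A} {f : c ⟶ d} {p : l ⟶ c} {q : l ⟶ d} {r : c ⟶ l} {Y : TwoCell l l}
    (L : IsLooseLimit P f p q r Y) (h : IsReflection P e g X) (v : a ⟶ d) (hv : IsTight v)
    (s : b ⟶ c) (hs : IsTight s) (hf : g ≫ v = s ≫ f) :
    (sq.lift h).1 ≫ R.mapTight v hv = R.mapTight s hs ≫ (sq.lift L.refl).1 ≫
      R.mapTight q L.tight := by
  -- The unit whiskered by `v` is a cone over `f`, with projections `e ≫ s` and `v`. Both are tight,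
  -- so the induced `t` is tight.
  obtain ⟨t, htp, htq, htY⟩ := L.exists_lift (e ≫ s) v (X.wr v)
    (by rw [TwoCell.wr_dom, h.dom_eq, Strict.id_comp])
    (by rw [TwoCell.wr_cod, h.cod_eq, Strict.assoc, hf, Strict.assoc])
    (fun hP => TwoCell.inv_wr (h.inv hP) v)
  have ht : IsTight t := L.tight_of t (htp ▸ tight_comp _ _ h.tight hs) (htq ▸ hv)
  -- Both 1-cells classify the identity cone on `f`, restricted along `s`.
  have hr : s ≫ r = g ≫ t := by
    refine L.hom_ext _ _ ?_ ?_ ?_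
    · rw [Strict.assoc, L.refl.right_comp, Strict.assoc, htp, ← Strict.assoc, h.right_comp,
        Strict.comp_id, Strict.id_comp]
    · rw [Strict.assoc, L.fac, Strict.assoc, htq, hf]
    · rw [← TwoCell.wl_wl, ← TwoCell.wl_wl, htY, ← TwoCell.wr_wl, L.refl.wl_eq, TwoCell.wr_one,
        ← TwoCell.wr_wl, h.wl_eq, TwoCell.wr_one, TwoCell.wl_one, L.fac, hf]
  -- The units are compatible because they agree after both projections: after `p` both are
  -- identities, after `q` this is the choice of `t`.
  have hX : X.wr t = Y.wl t := by
    refine L.cell_ext _ _ ?_ ?_ ?_ ?_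
    · rw [TwoCell.wr_dom, TwoCell.wl_dom, h.dom_eq, L.refl.dom_eq, Strict.comp_id, Strict.id_comp]
    · rw [TwoCell.wr_cod, TwoCell.wl_cod, h.cod_eq, L.refl.cod_eq, ← Strict.assoc t, htp,
        Strict.assoc, Strict.assoc, hr]
    · rw [TwoCell.wr_wr, htp, ← TwoCell.wr_wr, h.wr_eq, TwoCell.wr_one, TwoCell.wr_wl,
        L.refl.wr_eq, TwoCell.wl_one, htp]
    · rw [TwoCell.wr_wr, htq, TwoCell.wr_wl, htY]
  -- So `(t, s)` is a morphism of reflections in `A`. Its `S`-image is the `H`-image of the square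
  -- formed by `R` of `t` and `s` between the lifts, and Morph makes the lifted right adjoints
  -- commute.
  have key := sq.reflects (sq.lift_refl h) (sq.lift_refl L.refl) (R.mapTight t ht)
    (R.mapTight s hs) (R.tight_mapTight _ _) (R.tight_mapTight _ _)
    (by rw [R.mapTight_comp, R.mapTight_comp]; exact R.mapTight_congr htp _)
    (by rw [sq.map_lift, sq.map_lift, sq.map_eq, sq.map_eq, ← S.map_comp, ← S.map_comp, hr])
    (by rw [sq.mapCell_lift, sq.mapCell_lift, sq.map_eq, ← S.mapCell_wr, ← S.mapCell_wl, hX])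
  rw [← Strict.assoc, key, Strict.assoc, R.mapTight_comp]
  exact congrArg _ (R.mapTight_congr htq.symm hv)

end Lift

/-! ### The filler on 1-cells -/

/-- The action of the diagonal filler on 1-cells. -/
noncomputable def fill (f : a ⟶ b) : oR ⟨a⟩ ⟶ oR ⟨b⟩ :=
  (sq.lift (sq.limits f).choose_spec.choose_spec.choose_spec.choose_spec.choose_spec.refl).1 ≫
    R.mapTight _ (sq.limits f).choose_spec.choose_spec.choose_spec.choose_spec.choose_spec.tight

lemma lift_comp_mapTight {d : A} {e : a ⟶ b} {g : b ⟶ a} {X : TwoCell a a}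
    (h : IsReflection P e g X) {v : a ⟶ d} (hv : IsTight v) {s : b ⟶ c} (hs : IsTight s)
    {f : c ⟶ d} (hf : g ≫ v = s ≫ f) :
    (sq.lift h).1 ≫ R.mapTight v hv = R.mapTight s hs ≫ sq.fill f :=
  (sq.lift_square (sq.limits f).choose_spec.choose_spec.choose_spec.choose_spec.choose_spec
    h v hv s hs hf).trans rfl

/-- Independence of the chosen limit: any factorisation of `f` as a right adjoint of a reflection
followed by a tight 1-cell computes the filler. -/
lemma fill_eq {e : a ⟶ b} {g : b ⟶ a} {X : TwoCell a a} (h : IsReflection P e g X) {v : a ⟶ c}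
    (hv : IsTight v) {f : b ⟶ c} (hf : g ≫ v = f) :
    sq.fill f = (sq.lift h).1 ≫ R.mapTight v hv := by
  rw [sq.lift_comp_mapTight h hv (tight_id b) (hf.trans (Strict.id_comp f).symm), R.mapTight_id,
    Strict.id_comp]

lemma fill_right {e : a ⟶ b} {g : b ⟶ a} {X : TwoCell a a} (h : IsReflection P e g X) :
    sq.fill g = (sq.lift h).1 := by
  rw [sq.fill_eq h (tight_id a) (Strict.comp_id g), R.mapTight_id, Strict.comp_id]

lemma fill_tight (f : a ⟶ b) (hf : IsTight f) : sq.fill f = R.mapTight f hf := by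
  rw [sq.fill_eq (.id P a) hf (Strict.id_comp f), sq.lift_id, Strict.id_comp]

lemma fill_id (a : A) : sq.fill (𝟙 a) = 𝟙 _ := by
  rw [sq.fill_tight _ (tight_id a), R.mapTight_id]

lemma fill_comp (f : a ⟶ b) (h : b ⟶ c) : sq.fill (f ≫ h) = sq.fill f ≫ sq.fill h := by
  obtain ⟨l, p, q, r, X, L⟩ := sq.limits f
  -- With the limit of `q ≫ h` rather than of `h`, the sections compose, and `f ≫ h = (r ≫ r') ≫ q'`
  -- is again a factorisation of the required kind.
  obtain ⟨l', p', q', r', X', L'⟩ := sq.limits (q ≫ h)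
  rw [sq.fill_eq (L'.refl.comp L.refl) L'.tight (f := f ≫ h)
      (by rw [Strict.assoc, L'.fac, ← Strict.assoc, L.fac]),
    sq.lift_comp L'.refl L.refl, sq.fill_eq L.refl L.tight L.fac, Strict.assoc, Strict.assoc,
    sq.lift_comp_mapTight L'.refl L'.tight L.tight L'.fac]

lemma map_fill (f : a ⟶ b) : H.map (sq.fill f) = S.map f := by
  obtain ⟨l, p, q, r, X, L⟩ := sq.limits f
  rw [sq.fill_eq L.refl L.tight L.fac, H.map_comp, sq.map_lift, sq.map_eq, ← S.map_comp, L.fac]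

/-! ### The filler on 2-cells -/

/-- `Y` is a value of the diagonal filler at the 2-cell `X`. -/
structure IsFill (X : TwoCell a b) (Y : TwoCell (oR ⟨a⟩) (oR ⟨b⟩)) : Prop where
  dom_eq : Y.dom = sq.fill X.dom
  cod_eq : Y.cod = sq.fill X.cod
  mapCell_eq : H.mapCell Y = S.mapCell X

namespace IsFill

variable {sq}

lemma unique {X : TwoCell a b} {Y Y' : TwoCell (oR ⟨a⟩) (oR ⟨b⟩)} (h : sq.IsFill X Y)
    (h' : sq.IsFill X Y') : Y = Y' :=
  sq.faithful _ _ (h.dom_eq.trans h'.dom_eq.symm) (h.cod_eq.trans h'.cod_eq.symm)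
    (h.mapCell_eq.trans h'.mapCell_eq.symm)

lemma wl {X : TwoCell b c} {Y : TwoCell (oR ⟨b⟩) (oR ⟨c⟩)} (h : sq.IsFill X Y) (f : a ⟶ b) :
    sq.IsFill (X.wl f) (Y.wl (sq.fill f)) where
  dom_eq := by rw [TwoCell.wl_dom, TwoCell.wl_dom, h.dom_eq, sq.fill_comp]
  cod_eq := by rw [TwoCell.wl_cod, TwoCell.wl_cod, h.cod_eq, sq.fill_comp]
  mapCell_eq := by rw [H.mapCell_wl, S.mapCell_wl, h.mapCell_eq, sq.map_fill]

lemma wr {X : TwoCell a b} {Y : TwoCell (oR ⟨a⟩) (oR ⟨b⟩)} (h : sq.IsFill X Y) (f : b ⟶ c) :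
    sq.IsFill (X.wr f) (Y.wr (sq.fill f)) where
  dom_eq := by rw [TwoCell.wr_dom, TwoCell.wr_dom, h.dom_eq, sq.fill_comp]
  cod_eq := by rw [TwoCell.wr_cod, TwoCell.wr_cod, h.cod_eq, sq.fill_comp]
  mapCell_eq := by rw [H.mapCell_wr, S.mapCell_wr, h.mapCell_eq, sq.map_fill]

lemma comp {X X' : TwoCell a b} {Y Y' : TwoCell (oR ⟨a⟩) (oR ⟨b⟩)} (h : sq.IsFill X Y)
    (h' : sq.IsFill X' Y') (e : X.cod = X'.dom) :
    sq.IsFill (X.comp X' e)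
      (Y.comp Y' (h.cod_eq.trans ((congrArg sq.fill e).trans h'.dom_eq.symm))) where
  dom_eq := h.dom_eq
  cod_eq := h'.cod_eq
  mapCell_eq := by
    rw [H.mapCell_comp, S.mapCell_comp]
    exact TwoCell.comp_congr h.mapCell_eq h'.mapCell_eq _

variable (sq) in
lemma one (f : a ⟶ b) : sq.IsFill (.one f) (.one (sq.fill f)) where
  dom_eq := rfl
  cod_eq := rfl
  mapCell_eq := by rw [H.mapCell_one, S.mapCell_one, sq.map_fill]

variable (sq) in
lemma untight {X Y : TightPart A} (Z : TwoCell X Y) : sq.IsFill Z.untight (R.mapCell Z) where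
  dom_eq := (sq.fill_tight _ Z.dom.tight).symm
  cod_eq := (sq.fill_tight _ Z.cod.tight).symm
  mapCell_eq := (sq.mapCell_eq Z).symm

variable (sq) in
lemma unit {e : a ⟶ b} {g : b ⟶ a} {X : TwoCell a a} (h : IsReflection P e g X) :
    sq.IsFill X (sq.lift h).2 where
  dom_eq := by rw [(sq.lift_refl h).dom_eq, h.dom_eq, sq.fill_id]
  cod_eq := by
    rw [(sq.lift_refl h).cod_eq, h.cod_eq, sq.fill_comp, sq.fill_right h, sq.fill_tight _ h.tight]
  mapCell_eq := sq.mapCell_lift h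

/-- Needed in the pseudo case, where inverses of units enter the construction. -/
lemma inverse {X X' : TwoCell a b} {Y Y' : TwoCell (oR ⟨a⟩) (oR ⟨b⟩)} (h : sq.IsFill X Y)
    (e₁ : X.cod = X'.dom) (e₂ : X'.cod = X.dom) (hX : X.comp X' e₁ = .one X.dom)
    (d₁ : Y.cod = Y'.dom) (d₂ : Y'.cod = Y.dom) (hY : Y'.comp Y d₂ = .one Y.cod) :
    sq.IsFill X' Y' where
  dom_eq := by rw [← d₁, h.cod_eq, e₁]
  cod_eq := by rw [d₂, h.dom_eq, e₂]
  mapCell_eq := by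
    refine TwoCell.inverse_unique (X := S.mapCell X) ?_ ?_ ?_ ?_
    · rw [H.mapCell_cod, d₂, h.dom_eq, sq.map_fill]; rfl
    · exact congrArg S.map e₁
    · refine (TwoCell.comp_congr rfl h.mapCell_eq.symm _).trans ?_
      rw [← H.mapCell_comp _ _ d₂, hY, H.mapCell_one, h.cod_eq, sq.map_fill]; rfl
    · rw [← S.mapCell_comp _ _ e₁, hX, S.mapCell_one]; rfl

end IsFill

include sq in
-- Cones need not be invertible here, so the limit cone of `f` followed by `α` is a cone over `f'`.
-- It factors through the limit of `f'` by some `t`, and restricting along `r` kills the first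
-- factor. Thus `α` is a whiskering of a unit, whose value is known.
lemma exists_isFill_lax (hP : ¬ P) (X : TwoCell a b) : ∃ Y, sq.IsFill X Y := by
  obtain ⟨f, f', α⟩ := X
  obtain ⟨l, p, q, r, X, L⟩ := sq.limits f
  obtain ⟨l', p', q', r', X', L'⟩ := sq.limits f'
  have e : (X.wr q).cod = ((TwoCell.of α).wl p).dom := by
    rw [TwoCell.wr_cod, L.refl.cod_eq, Strict.assoc, L.fac]; rfl
  obtain ⟨t, -, htq, htX⟩ := L'.exists_lift p q ((X.wr q).comp ((TwoCell.of α).wl p) e)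
    (by rw [TwoCell.comp_dom, TwoCell.wr_dom, L.refl.dom_eq, Strict.id_comp]) rfl
    fun h => (hP h).elim
  have : (X'.wr q').wl (r ≫ t) = .of α := by
    rw [← TwoCell.wl_wl, htX, TwoCell.wl_comp]
    refine (TwoCell.comp_congr (X' := .one f) (Y' := .of α) ?_ ?_ _).trans (TwoCell.one_comp _ _ _)
    · rw [← TwoCell.wr_wl, L.refl.wl_eq, TwoCell.wr_one, L.fac]
    · rw [TwoCell.wl_wl, L.refl.right_comp, TwoCell.wl_id]
  exact ⟨_, this ▸ ((IsFill.unit sq L'.refl).wr q').wl (r ≫ t)⟩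

include sq in
-- Only invertible cones factor, so `α` cannot be absorbed into a cone. It is instead conjugated by
-- invertible units into a 2-cell between tight 1-cells, on which `R` acts.
lemma exists_isFill_pseudo (hP : P) (X : TwoCell a b) : ∃ Y, sq.IsFill X Y := by
  obtain ⟨f, f', α⟩ := X
  obtain ⟨l, p, q, r, X, L⟩ := sq.limits f
  -- The second limit sits over the first: on `k` the composites `u ≫ p ≫ f` and `u ≫ p ≫ f'` are
  -- isomorphic to the tight `u ≫ q` and `w`.
  obtain ⟨k, u, w, s, Z, M⟩ := sq.limits (p ≫ f')
  obtain ⟨Xi, x₁, x₂, hx₁, hx₂⟩ := TwoCell.exists_inverse (L.refl.inv hP)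
  obtain ⟨Zi, z₁, z₂, hz₁, hz₂⟩ := TwoCell.exists_inverse (M.refl.inv hP)
  obtain ⟨Xi', x₁', x₂', -, hx₂'⟩ := TwoCell.exists_inverse ((sq.lift_refl L.refl).inv hP)
  have hXi : sq.IsFill Xi Xi' := (IsFill.unit sq L.refl).inverse x₁ x₂ hx₁ x₁' x₂' hx₂'
  have hZ := IsFill.unit sq M.refl
  have e₁ : ((X.wr q).wl u).cod = ((TwoCell.of α).wl (u ≫ p)).dom := by
    rw [TwoCell.wl_cod, TwoCell.wr_cod, L.refl.cod_eq, Strict.assoc, L.fac, ← Strict.assoc]; rfl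
  have e₂ : ((TwoCell.of α).wl (u ≫ p)).cod = (Zi.wr w).dom := by
    rw [TwoCell.wr_dom, ← z₁, M.refl.cod_eq, Strict.assoc, M.fac, ← Strict.assoc]; rfl
  have e₃ : ((Xi.wr q).wl u).cod = ((X.wr q).wl u).dom := by
    rw [TwoCell.wl_cod, TwoCell.wr_cod, x₂]; rfl
  have e₄ : (Zi.wr w).cod = (Z.wr w).dom := by rw [TwoCell.wr_cod, z₂]; rfl
  have eL : ((Xi.wr q).wl u).comp ((X.wr q).wl u) e₃ = .one ((X.wr q).wl u).cod := by
    rw [← TwoCell.wl_comp u (Xi.wr q) (X.wr q) (congrArg (· ≫ q) x₂), ← TwoCell.wr_comp _ _ x₂,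
      hx₂, TwoCell.wr_one, TwoCell.wl_one]; rfl
  have eM : (Zi.wr w).comp (Z.wr w) e₄ = .one (Zi.wr w).dom := by
    rw [← TwoCell.wr_comp _ _ z₂, hz₂, TwoCell.wr_one, z₁]; rfl
  have key := TwoCell.comp_comp_cancel e₁ e₂ e₃ e₄ eL eM
  -- The conjugate `u ≫ q ≅ u ≫ p ≫ f ⟶ u ≫ p ≫ f' ≅ w`.
  obtain ⟨β, hβ⟩ := TwoCell.exists_of_eq
    ((((X.wr q).wl u).comp ((TwoCell.of α).wl (u ≫ p)) e₁).comp (Zi.wr w) e₂)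
    (f := u ≫ q) (g := w)
    (by change u ≫ X.dom ≫ q = _; rw [L.refl.dom_eq, Strict.id_comp])
    (by change Zi.cod ≫ w = _; rw [z₂, M.refl.dom_eq, Strict.id_comp])
  have hB : sq.IsFill (.of β) _ := IsFill.untight sq (X := ⟨k⟩) (Y := ⟨b⟩)
    ⟨⟨u ≫ q, tight_comp _ _ M.refl.tight L.tight⟩, ⟨w, M.tight⟩, ⟨β⟩⟩
  rw [hβ] at hB
  -- Undoing the conjugation leaves `α` whiskered by `u ≫ p`, and `r ≫ s` is a section of `u ≫ p`.
  have hN := ((((hXi.wr q).wl u).comp hB e₃).comp (hZ.wr w) e₄).wl (r ≫ s)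
  rw [key, TwoCell.wl_wl, Strict.assoc, ← Strict.assoc s, M.refl.right_comp, Strict.id_comp,
    L.refl.right_comp, TwoCell.wl_id] at hN
  exact ⟨_, hN⟩

/-- The diagonal filler is defined on all 2-cells. -/
lemma exists_isFill (X : TwoCell a b) : ∃ Y, sq.IsFill X Y := by
  by_cases hP : P
  · exact sq.exists_isFill_pseudo hP X
  · exact sq.exists_isFill_lax hP X

lemma exists_fill₂ {f g : a ⟶ b} (α : f ⟶ g) :
    ∃ β : sq.fill f ⟶ sq.fill g, sq.IsFill (.of α) (.of β) := by
  obtain ⟨Y, hY⟩ := sq.exists_isFill (.of α)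
  obtain ⟨β, rfl⟩ := Y.exists_of_eq hY.dom_eq hY.cod_eq
  exact ⟨β, hY⟩

/-- The action of the diagonal filler on 2-cells. -/
noncomputable def fill₂ {f g : a ⟶ b} (α : f ⟶ g) : sq.fill f ⟶ sq.fill g :=
  (sq.exists_fill₂ α).choose

lemma isFill_fill₂ {f g : a ⟶ b} (α : f ⟶ g) : sq.IsFill (.of α) (.of (sq.fill₂ α)) :=
  (sq.exists_fill₂ α).choose_spec

/-- The diagonal filler. -/
noncomputable def filler : FFunctorOn A B fun X => oR ⟨X⟩ where
  map := sq.fill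
  cell := sq.fill₂
  map_id := sq.fill_id
  map_comp := sq.fill_comp
  cell_id f := TwoCell.of_inj.1 ((sq.isFill_fill₂ _).unique (IsFill.one sq f))
  cell_comp α β := TwoCell.of_inj.1 (by
    rw [TwoCell.of_comp]
    refine (sq.isFill_fill₂ _).unique ?_
    rw [TwoCell.of_comp]
    exact (sq.isFill_fill₂ α).comp (sq.isFill_fill₂ β) rfl)
  cell_whiskerLeft f _ _ α := (sq.isFill_fill₂ _).unique ((sq.isFill_fill₂ α).wl f)
  cell_whiskerRight α f := (sq.isFill_fill₂ _).unique ((sq.isFill_fill₂ α).wr f)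
  map_tight f hf := by rw [sq.fill_tight f hf]; exact R.tight_mapTight f hf

lemma filler_untight {X Y : TightPart A} (Z : TwoCell X Y) :
    sq.filler.mapCell Z.untight = R.mapCell Z :=
  (sq.isFill_fill₂ _).unique (IsFill.untight sq Z)

lemma map_filler (X : TwoCell a b) : H.mapCell (sq.filler.mapCell X) = S.mapCell X :=
  (sq.isFill_fill₂ X.hom).mapCell_eq

/-- `K` sends the reflection `p ⊣ r` to a lift of its `S`-image, which is unique; this determines
`K` on `r`, hence on `f = r ≫ q`. -/
lemma eq_filler (K : FFunctorOn A B fun X => oR ⟨X⟩)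
    (h₁ : ∀ {X Y : TightPart A} (Z : TwoCell X Y), K.mapCell Z.untight = R.mapCell Z)
    (h₂ : ∀ {a b : A} (X : TwoCell a b), H.mapCell (K.mapCell X) = S.mapCell X) :
    K = sq.filler := by
  have ht : ∀ {a b : A} (f : a ⟶ b) (hf : IsTight f), K.map f = R.mapTight f hf :=
    fun {a b} f hf => congrArg TwoCell.dom (h₁ (X := ⟨a⟩) (Y := ⟨b⟩) (.one ⟨f, hf⟩))
  have hm : ∀ {a b : A} (f : a ⟶ b), K.map f = sq.fill f := by
    intro a b f
    obtain ⟨l, p, q, r, X, L⟩ := sq.limits f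
    have hr : K.map r = (sq.lift L.refl).1 := by
      refine sq.eq_lift L.refl ?_ (congrArg TwoCell.dom (h₂ (.one r))) (h₂ X)
      rw [← ht]
      exact L.refl.map K
    rw [sq.fill_eq L.refl L.tight L.fac, ← hr, ← ht q L.tight, ← K.map_comp, L.fac]
  refine FFunctorOn.ext_of_mapCell fun X => sq.faithful _ _ (hm _) (hm _) ?_
  rw [h₂, sq.map_filler]

end DoctrinalSquare

end

/-! ### Orthogonality from the doctrinal conditions -/

namespace FFunctor

variable {A : Type u₁} [FCategory.{w₁, v₁} A] {B : Type u₂} [FCategory.{w₂, v₂} B]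
  {C : Type u₃} [FCategory.{w₃, v₃} C] {D : Type u₄} [FCategory.{w₄, v₄} D]

lemma orthogonal_of_doctrinal (P : Prop) (hA : HasLooseLimitsEq P A) {H : FFunctor B C}
    (h₁ : H.toOn.LiftsReflections P) (h₂ : H.toOn.ReflectsMorphisms P) (h₃ : H.toOn.Faithful₂) :
    (TightPart.incl A).Orthogonal H := by
  intro R S e
  -- `TightPart A` has the objects of `A`, so the commuting square fixes `S` on objects.
  have hS : S.obj = fun X => H.obj (R.obj ⟨X⟩) :=
    funext fun X => congrFun (congrArg (fun F : FFunctor _ _ => F.obj) e) ⟨X⟩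
  obtain ⟨S, rfl⟩ := S.exists_on hS
  have e' : ((TightPart.incl A).comp S.toFFunctor).toOn = (R.comp H).toOn :=
    FFunctorOn.toFFunctor_inj (o := fun X => H.obj (R.obj X))
      ((toFFunctor_toOn _).trans (e.trans (toFFunctor_toOn _).symm))
  have sq : DoctrinalSquare P R.toOn H.toOn S :=
    { mapCell_eq := fun {X Y} Z => congrArg
        (fun F : FFunctorOn (TightPart A) C (fun X => H.obj (R.obj X)) => F.mapCell Z) e'
      limits := hA
      lifts := h₁
      reflects := h₂
      faithful := h₃ }
  refine ⟨sq.filler.toFFunctor, ⟨?_, ?_⟩, ?_⟩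
  · have : ((TightPart.incl A).comp sq.filler.toFFunctor).toOn = R.toOn :=
      FFunctorOn.ext_of_mapCell (o := R.obj) sq.filler_untight
    exact (toFFunctor_toOn _).symm.trans
      ((congrArg (FFunctorOn.toFFunctor (o := R.obj)) this).trans (toFFunctor_toOn _))
  · have : (sq.filler.toFFunctor.comp H).toOn = S :=
      FFunctorOn.ext_of_mapCell (o := fun X => H.obj (R.obj ⟨X⟩)) sq.map_filler
    exact (toFFunctor_toOn _).symm.trans
      (congrArg (FFunctorOn.toFFunctor (o := fun X => H.obj (R.obj ⟨X⟩))) this)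
  · rintro K ⟨hR, hH⟩
    have hK : K.obj = fun X => R.obj ⟨X⟩ :=
      funext fun X => congrFun (congrArg (fun F : FFunctor _ _ => F.obj) hR) ⟨X⟩
    obtain ⟨K, rfl⟩ := K.exists_on hK
    have hR' : ((TightPart.incl A).comp K.toFFunctor).toOn = R.toOn :=
      FFunctorOn.toFFunctor_inj (o := R.obj)
        ((toFFunctor_toOn _).trans (hR.trans (toFFunctor_toOn _).symm))
    have hH' : (K.toFFunctor.comp H).toOn = S :=
      FFunctorOn.toFFunctor_inj (o := fun X => H.obj (R.obj ⟨X⟩))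
        ((toFFunctor_toOn _).trans hH)
    exact congrArg _ (sq.eq_filler K
      (fun Z => congrArg (fun F : FFunctorOn (TightPart A) B R.obj => F.mapCell Z) hR')
      (fun X => congrArg
        (fun F : FFunctorOn A C (fun X => H.obj (R.obj ⟨X⟩)) => F.mapCell X) hH'))

/-! ### Duality -/

/-- The F-functor induced by one between the duals. -/
def unco (F : FFunctor (Co A) (Co B)) : FFunctor A B :=
  FFunctorOn.toFFunctor (o := fun X => (F.obj ⟨X⟩).obj)
    { map := fun {a b} f => (F.map (X := ⟨a⟩) (Y := ⟨b⟩) ⟨f⟩).hom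
      cell := fun {a b f g} α =>
        (F.map₂ (a := ⟨a⟩) (b := ⟨b⟩) (f := ⟨g⟩) (g := ⟨f⟩) ⟨α⟩).hom
      map_id := fun a => congrArg Co.Hom.hom (F.map_id ⟨a⟩)
      map_comp := fun f g =>
        congrArg Co.Hom.hom (F.map_comp (a := ⟨_⟩) (b := ⟨_⟩) (c := ⟨_⟩) ⟨f⟩ ⟨g⟩)
      cell_id := fun {a b} f =>
        congrArg Co.Hom₂.hom (F.map₂_id (a := ⟨a⟩) (b := ⟨b⟩) ⟨f⟩)
      cell_comp := fun {a b f g h} α β => congrArg Co.Hom₂.hom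
        (F.map₂_comp (a := ⟨a⟩) (b := ⟨b⟩) (f := ⟨h⟩) (g := ⟨g⟩) (h := ⟨f⟩) ⟨β⟩ ⟨α⟩)
      cell_whiskerLeft := fun {a b c} f {g h} α => congrArg
        (fun X : TwoCell (F.obj ⟨a⟩) (F.obj ⟨c⟩) => TwoCell.of (Co.Hom₂.hom X.hom))
        (F.toOn.cell_whiskerLeft (a := ⟨a⟩) (b := ⟨b⟩) (c := ⟨c⟩) ⟨f⟩ (g := ⟨h⟩) (h := ⟨g⟩) ⟨α⟩)
      cell_whiskerRight := fun {a b c g h} α f => congrArg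
        (fun X : TwoCell (F.obj ⟨a⟩) (F.obj ⟨c⟩) => TwoCell.of (Co.Hom₂.hom X.hom))
        (F.toOn.cell_whiskerRight (a := ⟨a⟩) (b := ⟨b⟩) (c := ⟨c⟩) (g := ⟨h⟩) (h := ⟨g⟩) ⟨α⟩ ⟨f⟩)
      map_tight := fun f hf => F.map_tight (a := ⟨_⟩) (b := ⟨_⟩) ⟨f⟩ hf }

lemma co_unco (F : FFunctor (Co A) (Co B)) : F.unco.co = F := ext_of_prelax rfl

lemma unco_co (F : FFunctor A B) : F.co.unco = F := ext_of_prelax rfl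

lemma co_injective {F G : FFunctor A B} (h : F.co = G.co) : F = G := by
  rw [← F.unco_co, h, unco_co]

lemma co_comp (F : FFunctor A B) (G : FFunctor B C) : (F.comp G).co = F.co.comp G.co :=
  ext_of_prelax rfl

lemma comp_assoc (F : FFunctor A B) (G : FFunctor B C) (K : FFunctor C D) :
    (F.comp G).comp K = F.comp (G.comp K) :=
  ext_of_prelax rfl

variable (A) in
/-- The comparison of the tight part of the dual with the dual of the tight part. -/
def tightCo : FFunctor (TightPart (Co A)) (Co (TightPart A)) :=
  FFunctorOn.toFFunctor (o := fun X => ⟨⟨X.obj.obj⟩⟩)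
    { map := fun f => ⟨⟨f.hom.hom, f.tight⟩⟩
      cell := fun α => ⟨⟨α.hom.hom⟩⟩
      map_id := fun _ => rfl
      map_comp := fun _ _ => rfl
      cell_id := fun _ => rfl
      cell_comp := fun _ _ => rfl
      cell_whiskerLeft := fun _ _ _ _ => rfl
      cell_whiskerRight := fun _ _ => rfl
      map_tight := fun _ _ => trivial }

variable (A) in
/-- The inverse of `tightCo`. -/
def coTight : FFunctor (Co (TightPart A)) (TightPart (Co A)) :=
  FFunctorOn.toFFunctor (o := fun X => ⟨⟨X.obj.obj⟩⟩)
    { map := fun f => ⟨⟨f.hom.hom⟩, f.hom.tight⟩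
      cell := fun α => ⟨⟨α.hom.hom⟩⟩
      map_id := fun _ => rfl
      map_comp := fun _ _ => rfl
      cell_id := fun _ => rfl
      cell_comp := fun _ _ => rfl
      cell_whiskerLeft := fun _ _ _ _ => rfl
      cell_whiskerRight := fun _ _ => rfl
      map_tight := fun _ _ => trivial }

lemma coTight_tightCo_comp (F : FFunctor (Co (TightPart A)) B) :
    (coTight A).comp ((tightCo A).comp F) = F :=
  ext_of_prelax rfl

lemma tightCo_comp_incl_co : (tightCo A).comp (TightPart.incl A).co = TightPart.incl (Co A) :=
  ext_of_prelax rfl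

/-- Dualisation is bijective on F-functors, and `tightCo` identifies the two orders of taking duals
and tight parts; lifting problems and their solutions correspond. -/
lemma Orthogonal.of_co {H : FFunctor B C} (h : (TightPart.incl (Co A)).Orthogonal H.co) :
    (TightPart.incl A).Orthogonal H := by
  intro R S e
  have iff₁ : ∀ K : FFunctor A B, (TightPart.incl A).comp K = R ↔
      (TightPart.incl (Co A)).comp K.co = (tightCo A).comp R.co := by
    intro K
    rw [← tightCo_comp_incl_co, comp_assoc, ← co_comp]
    refine ⟨fun h => by rw [h], fun h => co_injective ?_⟩
    rw [← coTight_tightCo_comp (A := A) (co _), h, coTight_tightCo_comp]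
  have iff₂ : ∀ K : FFunctor A B, K.comp H = S ↔ K.co.comp H.co = S.co := fun K =>
    ⟨fun h => by rw [← co_comp, h], fun h => co_injective (by rw [co_comp, h])⟩
  obtain ⟨K, hK, hu⟩ := h ((tightCo A).comp R.co) S.co (by
    rw [← tightCo_comp_incl_co, comp_assoc, ← co_comp, e, co_comp, comp_assoc])
  refine ⟨K.unco, ?_, fun K' hK' => ?_⟩
  · dsimp only
    rw [iff₁, iff₂, co_unco]
    exact hK
  · rw [← hu K'.co ⟨(iff₁ K').1 hK'.1, (iff₂ K').1 hK'.2⟩, unco_co]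

lemma LocallyFaithful.co {H : FFunctor A B} (h : H.LocallyFaithful) : H.co.LocallyFaithful :=
  fun _ _ _ _ α β e => Co.hom₂_ext (h α.hom β.hom (congrArg Co.Hom₂.hom e))

end FFunctor

theorem mainTheorem1 (wk : Weakness) (A : Type u₁) [FCategory.{w₁, v₁} A]
    (hA : HasLooseLimits wk.bar A)
    (B : Type u₂) [FCategory.{w₂, v₂} B] (C : Type u₃) [FCategory.{w₃, v₃} C]
    (H : FFunctor B C) (hH : H.IsDoctrinal wk) :
    (TightPart.incl A).Orthogonal H := by
  obtain ⟨h₁, h₂, h₃⟩ := hH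
  match wk with
  | .l =>
    exact FFunctor.orthogonal_of_doctrinal False (HasColaxLimits.hasLooseLimitsEq hA)
      (FFunctor.LRefl.liftsReflections h₁) (FFunctor.LMorph.reflectsMorphisms h₂) h₃.faithful₂
  | .p =>
    exact FFunctor.orthogonal_of_doctrinal True (HasPseudolimits.hasLooseLimitsEq hA)
      (FFunctor.PRefl.liftsReflections h₁) (FFunctor.PMorph.reflectsMorphisms h₂) h₃.faithful₂
  | .c =>
    -- Lax limits in `A` and the `c`-conditions on `H` are by definition colax limits in `Co A` and
    -- the `l`-conditions on `H.co`.
    exact FFunctor.Orthogonal.of_co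
      (FFunctor.orthogonal_of_doctrinal False (HasColaxLimits.hasLooseLimitsEq hA)
        (FFunctor.LRefl.liftsReflections h₁) (FFunctor.LMorph.reflectsMorphisms h₂)
        h₃.co.faithful₂)
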